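/- Let $Fm$ be the set of formulas built from a countably infinite set $Prop$ of propositional variables with the constant $0$, the binary connectives $*$ (strong conjunction) and $\to$, and the unary connectives $\square$ and $\lozenge$. Put $\neg\varphi := \varphi\to 0$, $\varphi\wedge\psi := \varphi*(\varphi\to\psi)$, $\varphi\vee\psi := ((\varphi\to\psi)\to\psi)\wedge((\psi\to\varphi)\to\varphi)$ and $\varphi\equiv\psi := (\varphi\to\psi)\wedge(\psi\to\varphi)$. The calculus $\mathrm{S5}(\mathcal{L})$ has as axioms all instances in $Fm$ of Hájek's axiom schemata for infinite-valued Łukasiewicz logic, namely - $(\varphi\to\psi)\to((\psi\to\chi)\to(\varphi\to\chi))$, - $(\varphi*\psi)\to\varphi$, - $(\varphi*\psi)\to(\psi*\varphi)$, - $(\varphi*(\varphi\to\psi))\to(\psi*(\psi\to\varphi))$, - $(\varphi\to(\psi\to\chi))\to((\varphi*\psi)\to\chi)$, - $((\varphi*\psi)\to\chi)\to(\varphi\to(\psi\to\chi))$, - $((\varphi\to\psi)\to\chi)\to(((\psi\to\varphi)\to\chi)\to\chi)$, - $0\to\varphi$, - $\neg\neg\varphi\to\varphi$, together with all formulas - $\square\varphi\to\varphi$,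 - $\varphi\to\lozenge\varphi$, - $\square(\nu\to\varphi)\to(\nu\to\square\varphi)$, - $\square(\varphi\to\nu)\to(\lozenge\varphi\to\nu)$, - $\square(\varphi\vee\nu)\to(\square\varphi\vee\nu)$, - $\lozenge(\varphi*\varphi)\equiv(\lozenge\varphi)*(\lozenge\varphi)$, where $\varphi$ is any formula and $\nu$ is any propositional combination of formulas beginning with $\square$ or $\lozenge$ (that is, $\nu$ is built from such formulas and $0$ using $*$ and $\to$). Its rules are Modus Ponens (from $\varphi$ and $\varphi\to\psi$ infer $\psi$) and Necessitation (from $\varphi$ infer $\square\varphi$). For $\Gamma\cup\{\varphi\}\subseteq Fm$ write $\Gamma\vdash\varphi$ if $\varphi$ is derivable from the axioms and the elements of $\Gamma$ by finitely many applications of these rules. A structure is a pair $\mathbf{K}=\langle X,e\rangle$ with $X$ a non-empty set and $e\colon X\times Prop\to[0,1]$. Truth values in $[0,1]$ are defined by $\|p\|_{\mathbf{K},x}=e(x,p)$ for $p\in Prop$, $\|0\|_{\mathbf{K},x}=0$, \[ \|\varphi*\psi\|_{\mathbf{K},x}=\max(0,\|\varphi\|_{\mathbf{K},x}+\|\psi\|_{\mathbf{K},x}-1),\qquad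 \|\varphi\to\psi\|_{\mathbf{K},x}=\min(1,1-\|\varphi\|_{\mathbf{K},x}+\|\psi\|_{\mathbf{K},x}), \] \[ \|\square\varphi\|_{\mathbf{K},x}=\inf_{x'\in X}\|\varphi\|_{\mathbf{K},x'},\qquad \|\lozenge\varphi\|_{\mathbf{K},x}=\sup_{x'\in X}\|\varphi\|_{\mathbf{K},x'}. \] $\mathbf{K}$ is a model of $\Gamma$ if $\|\gamma\|_{\mathbf{K},x}=1$ for all $\gamma\in\Gamma$ and $x\in X$. Write $\Gamma\vDash\varphi$ if every model of $\Gamma$ is a model of $\{\varphi\}$; this is the logic $\mathrm{S5}([0,1]_{\text{Ł}})$. **Theorem.** $\mathrm{S5}(\mathcal{L})$ is finitely strongly complete with respect to $\mathrm{S5}([0,1]_{\text{Ł}})$: for every finite $\Gamma\subseteq Fm$ and every $\varphi\in Fm$, \[ \Gamma\vdash\varphi\iff\Gamma\vDash\varphi . \] In other words, $\mathrm{S5}(\mathcal{L})$ is the finitary companion of $\mathrm{S5}([0,1]_{\text{Ł}})$: for every $\Gamma\subseteq Fm$ and $\varphi\in Fm$, $\Gamma\vdash\varphi$ if and only if $\Delta\vDash\varphi$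 for some finite $\Delta\subseteq\Gamma$. -/

import Mathlib

universe u

namespace S5Luk

/-- Formulas over the countably infinite set `ℕ` of propositional variables, in the language
`0, *, →` of Basic Logic expanded with the unary connectives `□` and `◇`. -/
inductive Fm : Type
  | var (p : ℕ) : Fm
  | bot : Fm
  | conj (φ ψ : Fm) : Fm
  | imp (φ ψ : Fm) : Fm
  | box (φ : Fm) : Fm
  | dia (φ : Fm) : Fm

namespace Fm

/-- Strong conjunction. -/
infixr:70 " ⊛ " => Fm.conj

/-- Implication. -/
infixr:60 " ⇒ " => Fm.imp

/-- `¬ φ` abbreviates `φ → 0`. -/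
def neg (φ : Fm) : Fm := φ ⇒ bot

/-- `φ ∧ ψ` abbreviates `φ * (φ → ψ)`. -/
def and (φ ψ : Fm) : Fm := φ ⊛ (φ ⇒ ψ)

/-- `φ ∨ ψ` abbreviates `((φ → ψ) → ψ) ∧ ((ψ → φ) → φ)`. -/
def or (φ ψ : Fm) : Fm := and ((φ ⇒ ψ) ⇒ ψ) ((ψ ⇒ φ) ⇒ φ)

/-- `φ ≡ ψ` abbreviates `(φ → ψ) ∧ (ψ → φ)`. -/
def equiv (φ ψ : Fm) : Fm := and (φ ⇒ ψ) (ψ ⇒ φ)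

/-- Propositional combinations of formulas beginning with `□` or `◇`. -/
inductive IsModalComb : Fm → Prop
  | box (φ : Fm) : IsModalComb (box φ)
  | dia (φ : Fm) : IsModalComb (dia φ)
  | bot : IsModalComb bot
  | conj {φ ψ : Fm} : IsModalComb φ → IsModalComb ψ → IsModalComb (φ ⊛ ψ)
  | imp {φ ψ : Fm} : IsModalComb φ → IsModalComb ψ → IsModalComb (φ ⇒ ψ)

end Fm

open Fm

/-- Instances, in the modal language, of the axiom schemata of infinite-valued Łukasiewicz logic:
Hájek's axioms of Basic Logic together with the law of double negation. -/
inductive LukAxiom : Fm → Prop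
  | trans (φ ψ χ : Fm) : LukAxiom ((φ ⇒ ψ) ⇒ (ψ ⇒ χ) ⇒ (φ ⇒ χ))
  | weak (φ ψ : Fm) : LukAxiom ((φ ⊛ ψ) ⇒ φ)
  | comm (φ ψ : Fm) : LukAxiom ((φ ⊛ ψ) ⇒ (ψ ⊛ φ))
  | divis (φ ψ : Fm) : LukAxiom ((φ ⊛ (φ ⇒ ψ)) ⇒ (ψ ⊛ (ψ ⇒ φ)))
  | uncurry (φ ψ χ : Fm) : LukAxiom ((φ ⇒ (ψ ⇒ χ)) ⇒ ((φ ⊛ ψ) ⇒ χ))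
  | curry (φ ψ χ : Fm) : LukAxiom (((φ ⊛ ψ) ⇒ χ) ⇒ (φ ⇒ (ψ ⇒ χ)))
  | prelin (φ ψ χ : Fm) : LukAxiom (((φ ⇒ ψ) ⇒ χ) ⇒ (((ψ ⇒ φ) ⇒ χ) ⇒ χ))
  | exfalso (φ : Fm) : LukAxiom (bot ⇒ φ)
  | dneg (φ : Fm) : LukAxiom (neg (neg φ) ⇒ φ)

/-- Axioms of the calculus `S5(Ł)`. -/
inductive S5Axiom : Fm → Prop
  | luk {φ : Fm} : LukAxiom φ → S5Axiom φ
  | box_elim (φ : Fm) : S5Axiom (box φ ⇒ φ)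
  | dia_intro (φ : Fm) : S5Axiom (φ ⇒ dia φ)
  | box_imp (φ ν : Fm) : IsModalComb ν → S5Axiom (box (ν ⇒ φ) ⇒ (ν ⇒ box φ))
  | box_imp_dia (φ ν : Fm) : IsModalComb ν → S5Axiom (box (φ ⇒ ν) ⇒ (dia φ ⇒ ν))
  | box_or (φ ν : Fm) : IsModalComb ν → S5Axiom (box (or φ ν) ⇒ or (box φ) ν)
  | dia_conj (φ : Fm) : S5Axiom (equiv (dia (φ ⊛ φ)) (dia φ ⊛ dia φ))

/-- `Provable Γ φ` is `Γ ⊢ φ` in `S5(Ł)`; necessitation applies to everything derived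
from `Γ`, not only to theorems. -/
inductive Provable (Γ : Set Fm) : Fm → Prop
  | hyp {φ : Fm} : φ ∈ Γ → Provable Γ φ
  | ax {φ : Fm} : S5Axiom φ → Provable Γ φ
  | mp {φ ψ : Fm} : Provable Γ φ → Provable Γ (φ ⇒ ψ) → Provable Γ ψ
  | nec {φ : Fm} : Provable Γ φ → Provable Γ (box φ)

/-- The Łukasiewicz t-norm `x * y = max(0, x + y - 1)` on `[0,1]`. -/
noncomputable def tnorm (x y : unitInterval) : unitInterval :=
  ⟨max 0 ((x : ℝ) + y - 1), le_max_left _ _,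
    max_le zero_le_one (by have := x.2.2; have := y.2.2; linarith)⟩

/-- Its residuum `x → y = min(1, 1 - x + y)`. -/
noncomputable def resid (x y : unitInterval) : unitInterval :=
  ⟨min 1 (1 - (x : ℝ) + y),
    le_min zero_le_one (by have := x.2.2; have := y.2.1; linarith), min_le_left _ _⟩

/-- Truth value of a formula at a point of the structure `⟨X, e, [0,1]⟩`. The infimum and
supremum are those of the complete lattice `[0,1]`, so every structure is safe. -/
noncomputable def truth {X : Type*} (e : X → ℕ → unitInterval) : Fm → X → unitInterval
  | .var p, x => e x p
  | .bot, _ => 0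
  | .conj φ ψ, x => tnorm (truth e φ x) (truth e ψ x)
  | .imp φ ψ, x => resid (truth e φ x) (truth e ψ x)
  | .box φ, _ => ⨅ x', truth e φ x'
  | .dia φ, _ => ⨆ x', truth e φ x'

/-- `⟨X, e, [0,1]⟩` is a model of `Γ`. -/
def IsModel {X : Type*} (e : X → ℕ → unitInterval) (Γ : Set Fm) : Prop :=
  ∀ φ ∈ Γ, ∀ x, truth e φ x = 1

/-- `Γ ⊨ φ` in `S5([0,1])`: over every non-empty universe, every model of `Γ` is a model
of `φ`. -/
def Entails (Γ : Set Fm) (φ : Fm) : Prop :=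
  ∀ (X : Type u) [Nonempty X] (e : X → ℕ → unitInterval), IsModel e Γ → IsModel e {φ}

end S5Luk

/-! Soundness is a check of the axioms, since a modal combination has the same value at all points.
For completeness, let `Γ` be finite and not derive `φ`. Zorn's lemma gives a deductively closed `T ⊇
Γ` that omits `φ` and is linear on modal combinations. The calculus proves `◇(a → □a)` and `◇(◇a →
a)` (`dia_imp_box_mem`, `dia_dia_imp_mem`), and every `θ` with `◇θ ∈ T` lies in a prime theory that
extends `T` without new modal combinations (`exists_primeTheory`). So infima and suprema are
witnessed in Lindenbaum chains with a common modal part, and one prime theory for each relevant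
subformula gives a finite set of worlds.

It remains to replace all these chains by `[0,1]` simultaneously, keeping modal values common. An
MV-chain is the unit interval of an ordered group, where the connectives become linear relations
between sums of at most two elements. The comparisons that hold form a finite system of rational
linear inequalities, with one shared unknown per modal combination and one unknown per world for any
other formula. If no solution put `□φ` below `⊤`, `farkas` would produce `N⊤ ≤ N□φ` as a
natural-number combination of these inequalities. The local unknowns cancel inside each world; what
is left compares sums of modal combinations, so it transfers to a single chain (`FmSumLE.congr`,
`fmSumLE_of_count_eq`) and contradicts `□φ ∉ T`. A solution divided by the value of `⊤` is a model
of `Γ` that refutes `φ`. -/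

namespace S5Luk

open Fm

/-! ### Soundness and finitarity. -/

section Soundness

variable {X : Type*} (e : X → ℕ → unitInterval)

@[simp] lemma coe_tnorm (x y : unitInterval) : (tnorm x y : ℝ) = max 0 ((x : ℝ) + y - 1) := rfl

@[simp] lemma coe_resid (x y : unitInterval) : (resid x y : ℝ) = min 1 (1 - (x : ℝ) + y) := rfl

lemma resid_eq_one_iff {x y : unitInterval} : resid x y = 1 ↔ x ≤ y := by
  rw [← Subtype.coe_inj, ← Subtype.coe_le_coe]
  simp only [coe_resid, Set.Icc.coe_one, min_eq_left_iff]
  constructor <;> intro h <;> linarith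

lemma truth_and (φ ψ : Fm) (x : X) :
    truth e (Fm.and φ ψ) x = truth e φ x ⊓ truth e ψ x := by
  have h1 := (truth e φ x).2.1
  have h3 := (truth e φ x).2.2
  have h2 := (truth e ψ x).2.1
  apply Subtype.ext
  rcases le_total (truth e φ x) (truth e ψ x) with h | h
  · rw [inf_eq_left.2 h]
    have h' : (truth e φ x : ℝ) ≤ truth e ψ x := h
    simp only [Fm.and, truth, coe_tnorm, coe_resid]
    rw [min_eq_left (by linarith), max_eq_right (by linarith)]
    ring
  · rw [inf_eq_right.2 h]
    have h' : (truth e ψ x : ℝ) ≤ truth e φ x := h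
    simp only [Fm.and, truth, coe_tnorm, coe_resid]
    rw [min_eq_right (by linarith), max_eq_right (by linarith)]
    ring

lemma truth_or (φ ψ : Fm) (x : X) :
    truth e (Fm.or φ ψ) x = truth e φ x ⊔ truth e ψ x := by
  have h0 := (truth e φ x).2.1
  have h1 := (truth e φ x).2.2
  have h2 := (truth e ψ x).2.1
  have h3 := (truth e ψ x).2.2
  rw [Fm.or, truth_and]
  have key : ∀ a b : unitInterval, resid (resid a b) b = a ⊔ b := by
    intro a b
    have := a.2.1; have := a.2.2; have := b.2.1; have := b.2.2
    apply Subtype.ext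
    rcases le_total a b with h | h
    · rw [sup_eq_right.2 h]
      have h' : (a : ℝ) ≤ b := h
      simp only [coe_resid]
      rw [min_eq_left (b := 1 - (a : ℝ) + b) (by linarith), min_eq_right (by linarith)]
      ring
    · rw [sup_eq_left.2 h]
      have h' : (b : ℝ) ≤ a := h
      simp only [coe_resid]
      rw [min_eq_right (b := 1 - (a : ℝ) + b) (by linarith), min_eq_right (by linarith)]
      ring
  simp only [truth, key, sup_comm (truth e ψ x), inf_idem]

lemma truth_modalComb {ν : Fm} (h : IsModalComb ν) (x y : X) : truth e ν x = truth e ν y := by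
  induction h with
  | box φ => rfl
  | dia φ => rfl
  | bot => rfl
  | conj _ _ h1 h2 => simp only [truth, h1, h2]
  | imp _ _ h1 h2 => simp only [truth, h1, h2]

lemma truth_lukAxiom {φ : Fm} (h : LukAxiom φ) (x : X) : truth e φ x = 1 := by
  cases h with
  | divis φ ψ =>
    have := truth_and e φ ψ x
    have h2 := truth_and e ψ φ x
    simp only [Fm.and, truth] at this h2
    simp only [truth, resid_eq_one_iff, this, h2, inf_comm, le_refl]
  | trans φ ψ χ =>
    simp only [truth, resid_eq_one_iff]
    rw [← Subtype.coe_le_coe]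
    have := (truth e φ x).2.1; have := (truth e φ x).2.2
    have := (truth e ψ x).2.1; have := (truth e ψ x).2.2
    have := (truth e χ x).2.1; have := (truth e χ x).2.2
    simp only [coe_resid]
    grind
  | weak φ ψ =>
    simp only [truth, resid_eq_one_iff]
    rw [← Subtype.coe_le_coe]
    have := (truth e φ x).2.1; have := (truth e ψ x).2.2
    simp only [coe_tnorm]
    grind
  | comm φ ψ =>
    simp only [truth, resid_eq_one_iff]
    rw [← Subtype.coe_le_coe]
    simp only [coe_tnorm]
    grind
  | uncurry φ ψ χ =>
    simp only [truth, resid_eq_one_iff]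
    rw [← Subtype.coe_le_coe]
    have := (truth e φ x).2.1; have := (truth e φ x).2.2
    have := (truth e ψ x).2.1; have := (truth e ψ x).2.2
    have := (truth e χ x).2.1; have := (truth e χ x).2.2
    simp only [coe_resid, coe_tnorm]
    grind
  | curry φ ψ χ =>
    simp only [truth, resid_eq_one_iff]
    rw [← Subtype.coe_le_coe]
    have := (truth e φ x).2.1; have := (truth e φ x).2.2
    have := (truth e ψ x).2.1; have := (truth e ψ x).2.2
    have := (truth e χ x).2.1; have := (truth e χ x).2.2
    simp only [coe_resid, coe_tnorm]
    grind
  | prelin φ ψ χ =>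
    simp only [truth, resid_eq_one_iff]
    rw [← Subtype.coe_le_coe]
    have := (truth e φ x).2.1; have := (truth e φ x).2.2
    have := (truth e ψ x).2.1; have := (truth e ψ x).2.2
    have := (truth e χ x).2.1; have := (truth e χ x).2.2
    simp only [coe_resid]
    grind
  | exfalso φ =>
    simp only [truth, resid_eq_one_iff]
    exact (truth e φ x).2.1
  | dneg φ =>
    simp only [neg, truth, resid_eq_one_iff]
    rw [← Subtype.coe_le_coe]
    have := (truth e φ x).2.1; have := (truth e φ x).2.2
    simp only [coe_resid, Set.Icc.coe_zero]
    grind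

lemma le_resid_iff {a b c : unitInterval} : a ≤ resid b c ↔ (a : ℝ) + b - 1 ≤ c := by
  have := a.2.2
  rw [← Subtype.coe_le_coe, coe_resid, le_min_iff]
  constructor
  · rintro ⟨-, h⟩
    linarith
  · intro h
    exact ⟨this, by linarith⟩

lemma le_resid_iff_tnorm_le {a b c : unitInterval} : a ≤ resid b c ↔ tnorm a b ≤ c := by
  rw [le_resid_iff, ← Subtype.coe_le_coe, coe_tnorm, max_le_iff]
  exact ⟨fun h => ⟨c.2.1, h⟩, fun h => h.2⟩

lemma le_resid_comm {a b c : unitInterval} : a ≤ resid b c ↔ b ≤ resid a c := by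
  rw [le_resid_iff, le_resid_iff, add_comm (a : ℝ)]

lemma tnorm_mono {a b c d : unitInterval} (h : a ≤ c) (h' : b ≤ d) : tnorm a b ≤ tnorm c d := by
  have h1 : (a : ℝ) ≤ c := h
  have h2 : (b : ℝ) ≤ d := h'
  rw [← Subtype.coe_le_coe, coe_tnorm, coe_tnorm]
  exact max_le_max le_rfl (by linarith)

/-- The semantic content of the axiom `dia_conj`: squaring is monotone and continuous, so it
commutes with suprema. -/
lemma iSup_tnorm_self {ι : Sort*} (f : ι → unitInterval) :
    ⨆ i, tnorm (f i) (f i) = tnorm (⨆ i, f i) (⨆ i, f i) := by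
  apply le_antisymm
  · exact iSup_le fun i => tnorm_mono (le_iSup f i) (le_iSup f i)
  · set c := ⨆ i, tnorm (f i) (f i) with hc
    have hc0 := c.2.1
    have hc1 := c.2.2
    -- The bound is the solution `y` of `2y - 1 = c`.
    have h : ⨆ i, f i ≤ (⟨((c : ℝ) + 1) / 2, by linarith, by linarith⟩ : unitInterval) := by
      refine iSup_le fun i => ?_
      have h1 : tnorm (f i) (f i) ≤ c := le_iSup (fun i => tnorm (f i) (f i)) i
      have h2 : (f i : ℝ) + f i - 1 ≤ c := (le_max_right _ _).trans h1
      change (f i : ℝ) ≤ ((c : ℝ) + 1) / 2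
      linarith
    refine (tnorm_mono h h).trans ?_
    rw [← Subtype.coe_le_coe, coe_tnorm]
    exact max_le hc0 (by simp only; linarith)

lemma truth_s5Axiom {φ : Fm} (h : S5Axiom φ) (x : X) : truth e φ x = 1 := by
  cases h with
  | luk h => exact truth_lukAxiom e h x
  | box_elim φ =>
    rw [truth, resid_eq_one_iff]
    exact iInf_le (truth e φ) x
  | dia_intro φ =>
    rw [truth, resid_eq_one_iff]
    exact le_iSup (truth e φ) x
  | box_imp φ ν hν =>
    simp only [truth, resid_eq_one_iff]
    rw [le_resid_iff_tnorm_le]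
    refine le_iInf fun y => ?_
    rw [← le_resid_iff_tnorm_le]
    refine (iInf_le _ y).trans ?_
    rw [truth_modalComb e hν y x]
  | box_imp_dia φ ν hν =>
    simp only [truth, resid_eq_one_iff]
    rw [le_resid_comm]
    refine iSup_le fun y => ?_
    rw [le_resid_comm]
    refine (iInf_le _ y).trans ?_
    rw [truth_modalComb e hν y x]
  | box_or φ ν hν =>
    rw [truth, resid_eq_one_iff, truth_or]
    simp only [truth, truth_or]
    rw [iInf_sup_eq]
    refine le_iInf fun y => (iInf_le _ y).trans ?_
    rw [truth_modalComb e hν y x]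
  | dia_conj φ =>
    rw [equiv, truth_and]
    simp only [truth, iSup_tnorm_self]
    rw [resid_eq_one_iff.2 le_rfl, inf_idem]

end Soundness

lemma Provable.sound {Γ : Set Fm} {φ : Fm} (h : Provable Γ φ) {X : Type*}
    {e : X → ℕ → unitInterval} (he : IsModel e Γ) (x : X) : truth e φ x = 1 := by
  induction h generalizing x with
  | hyp h => exact he _ h x
  | ax h => exact truth_s5Axiom e h x
  | mp _ _ h1 h2 =>
    have := h2 x
    rw [truth, resid_eq_one_iff, h1 x] at this
    exact le_antisymm unitInterval.le_one' this
  | nec _ h =>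
    rw [truth]
    exact le_antisymm unitInterval.le_one' (le_iInf fun y => (h y).ge)

lemma Provable.mono {Γ Δ : Set Fm} (hΓ : Γ ⊆ Δ) {φ : Fm} (h : Provable Γ φ) : Provable Δ φ := by
  induction h with
  | hyp h => exact .hyp (hΓ h)
  | ax h => exact .ax h
  | mp _ _ h1 h2 => exact .mp h1 h2
  | nec _ h => exact .nec h

lemma Provable.exists_finite {Γ : Set Fm} {φ : Fm} (h : Provable Γ φ) :
    ∃ Δ ⊆ Γ, Δ.Finite ∧ Provable Δ φ := by
  induction h with
  | hyp h => exact ⟨{_}, Set.singleton_subset_iff.2 h, Set.finite_singleton _, .hyp rfl⟩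
  | ax h => exact ⟨∅, Set.empty_subset _, Set.finite_empty, .ax h⟩
  | mp _ _ h1 h2 =>
    obtain ⟨Δ, hΔ, hf, h⟩ := h1
    obtain ⟨Δ', hΔ', hf', h'⟩ := h2
    exact ⟨Δ ∪ Δ', Set.union_subset hΔ hΔ', hf.union hf',
      .mp (h.mono Set.subset_union_left) (h'.mono Set.subset_union_right)⟩
  | nec _ h =>
    obtain ⟨Δ, hΔ, hf, h⟩ := h
    exact ⟨Δ, hΔ, hf, .nec h⟩

/-! ### Arithmetic of MV-algebras. -/

/-- MV-algebras, presented as integral residuated commutative monoids that are divisible and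
involutive. -/
class MVAlgebra (A : Type*) [PartialOrder A] [BoundedOrder A] where
  conj : A → A → A
  res : A → A → A
  conj_comm (a b : A) : conj a b = conj b a
  conj_assoc (a b c : A) : conj (conj a b) c = conj a (conj b c)
  top_conj (a : A) : conj ⊤ a = a
  le_res_iff {a b c : A} : a ≤ res b c ↔ conj a b ≤ c
  conj_res_comm (a b : A) : conj a (res a b) = conj b (res b a)
  res_res_bot (a : A) : res (res a ⊥) ⊥ = a

namespace MVAlgebra

section Poset

variable {A : Type*} [PartialOrder A] [BoundedOrder A] [MVAlgebra A] {a b c d : A}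

/-- The involution. -/
def compl (a : A) : A := res a ⊥

/-- The truncated sum. -/
def oplus (a b : A) : A := res (compl a) b

lemma conj_top (a : A) : conj a ⊤ = a := by rw [conj_comm, top_conj]

lemma conj_left_comm (a b c : A) : conj a (conj b c) = conj b (conj a c) := by
  rw [← conj_assoc, conj_comm a b, conj_assoc]

lemma le_res_comm : a ≤ res b c ↔ b ≤ res a c := by
  rw [le_res_iff, le_res_iff, conj_comm]

lemma conj_mono_left (h : a ≤ b) (c : A) : conj a c ≤ conj b c :=
  le_res_iff.1 (h.trans (le_res_iff.2 le_rfl))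

lemma conj_mono (h : a ≤ b) (h' : c ≤ d) : conj a c ≤ conj b d := by
  refine (conj_mono_left h c).trans ?_
  rw [conj_comm b, conj_comm b]
  exact conj_mono_left h' b

lemma conj_le_left (a b : A) : conj a b ≤ a := by
  simpa [conj_top] using conj_mono (le_refl a) (le_top (a := b))

lemma conj_le_right (a b : A) : conj a b ≤ b := by
  rw [conj_comm]
  exact conj_le_left b a

lemma conj_res_le (a b : A) : conj a (res a b) ≤ b := by
  rw [conj_comm]
  exact le_res_iff.1 le_rfl

lemma res_eq_top_iff : res a b = ⊤ ↔ a ≤ b := by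
  rw [← top_le_iff, le_res_iff, top_conj]

/-- By divisibility `c = a * (a → c)` whenever `c ≤ a`; hence `a * (a → b)` is the meet of `a` and
`b`. -/
lemma le_conj_res (h : c ≤ a) (h' : c ≤ b) : c ≤ conj a (res a b) := by
  have h1 : c = conj a (res a c) := by
    rw [conj_res_comm, res_eq_top_iff.2 h, conj_top]
  calc c = conj a (res a c) := h1
    _ ≤ conj a (res a b) := conj_mono le_rfl (le_res_iff.2 (le_trans (le_res_iff.1 le_rfl) h'))

lemma conj_res_of_le (h : b ≤ a) : conj a (res a b) = b :=
  le_antisymm (conj_res_le a b) (le_conj_res h le_rfl)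

lemma res_mono (h : b ≤ a) (h' : c ≤ d) : res a c ≤ res b d := by
  refine le_res_iff.2 (le_trans (conj_mono le_rfl h) (le_trans ?_ h'))
  exact le_res_iff.1 le_rfl

lemma le_res (a b : A) : a ≤ res b a := le_res_iff.2 (conj_le_left a b)

lemma top_res (a : A) : res ⊤ a = a :=
  le_antisymm (by rw [← conj_top (res ⊤ a)]; exact le_res_iff.1 le_rfl) (le_res a ⊤)

@[simp] lemma compl_compl (a : A) : compl (compl a) = a := res_res_bot a

lemma le_compl_comm : a ≤ compl b ↔ b ≤ compl a := le_res_comm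

lemma compl_le_compl (h : a ≤ b) : compl b ≤ compl a := res_mono h le_rfl

lemma compl_le_comm : compl a ≤ b ↔ compl b ≤ a :=
  ⟨fun h => by simpa using compl_le_compl h, fun h => by simpa using compl_le_compl h⟩

lemma compl_conj (a b : A) : compl (conj a b) = res a (compl b) := by
  refine eq_of_forall_le_iff fun c => ?_
  rw [compl, compl, le_res_iff, le_res_iff, le_res_iff, conj_assoc]

lemma res_eq_res_compl (a b : A) : res a b = res (compl b) (compl a) := by
  rw [← compl_conj, conj_comm, compl_conj, compl_compl]

lemma conj_eq_bot_iff : conj a b = ⊥ ↔ a ≤ compl b := by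
  rw [compl, le_res_iff, le_bot_iff]

lemma oplus_eq (a b : A) : oplus a b = compl (conj (compl a) (compl b)) := by
  rw [compl_conj, compl_compl, oplus]

lemma oplus_comm (a b : A) : oplus a b = oplus b a := by
  rw [oplus_eq, oplus_eq, conj_comm]

lemma oplus_left_comm (a b c : A) : oplus a (oplus b c) = oplus b (oplus a c) := by
  simp only [oplus_eq, compl_compl, conj_left_comm]

lemma oplus_eq_top_iff : oplus a b = ⊤ ↔ compl a ≤ b := res_eq_top_iff

lemma oplus_mono (h : a ≤ b) (h' : c ≤ d) : oplus a c ≤ oplus b d :=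
  res_mono (compl_le_compl h) h'

lemma le_oplus_left (a b : A) : b ≤ oplus a b := le_res _ _

lemma le_oplus_right (a b : A) : a ≤ oplus a b := by
  rw [oplus_comm]
  exact le_res _ _

lemma oplus_bot (a : A) : oplus a ⊥ = a := res_res_bot a

/-- Read in the group: `(1 - a) + (a + b) - 1 = b`. The hypothesis says that `a + b` is not
truncated. The next three lemmas are cancellations of the same kind. -/
lemma conj_compl_oplus (h : b ≤ compl a) : conj (compl a) (oplus a b) = b := conj_res_of_le h

lemma oplus_conj_compl (h : a ≤ b) : oplus a (conj (compl a) b) = b := by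
  rw [oplus_eq, compl_conj (compl a) b, conj_res_of_le (compl_le_compl h), compl_compl]

lemma compl_oplus_conj (h : compl a ≤ b) : oplus (compl a) (conj a b) = b := by
  simpa using oplus_conj_compl h

lemma res_conj (h : compl a ≤ b) : res a (conj a b) = b := by
  have := compl_oplus_conj h
  rwa [oplus, compl_compl] at this

/-- Both sides are the join; contraposition reduces its symmetry to that of the meet, which is
divisibility. -/
lemma res_res_comm (a b : A) : res (res a b) b = res (res b a) a := by
  have key : ∀ a b : A, res (res a b) b = compl (conj (compl b) (res (compl b) (compl a))) := by
    intro a b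
    rw [conj_comm, compl_conj, compl_compl, ← res_eq_res_compl]
  rw [key, key, conj_res_comm]

end Poset

/-! ### The ordered group of an MV-chain. -/

section Chain

variable {A : Type*} [LinearOrder A] [BoundedOrder A] [MVAlgebra A] {a b c d : A}

/-- Linearity enters here: for each pair at least one of the two truncations is active, so `shift`
loses nothing in either branch. -/
lemma conj_eq_bot_of_oplus_ne_top (h : oplus a b ≠ ⊤) : conj a b = ⊥ := by
  rw [Ne, oplus_eq_top_iff, not_le] at h
  rw [conj_eq_bot_iff, le_compl_comm]
  exact h.le

/-- A pair `(m, c)` with `c ≠ ⊤` stands for the element `m + c` of the ordered group of a chain;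
`shift a` is addition of `a`. -/
noncomputable def shift (a : A) (x : ℕ × A) : ℕ × A :=
  open Classical in
  if oplus a x.2 = ⊤ then (x.1 + 1, conj a x.2) else (x.1, oplus a x.2)

lemma shift_of_eq {m : ℕ} (h : oplus a c = ⊤) : shift a (m, c) = (m + 1, conj a c) := if_pos h

lemma shift_of_ne {m : ℕ} (h : oplus a c ≠ ⊤) : shift a (m, c) = (m, oplus a c) := if_neg h

lemma shift_snd_ne_top {x : ℕ × A} (hx : x.2 ≠ ⊤) : (shift a x).2 ≠ ⊤ := by
  obtain ⟨m, c⟩ := x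
  by_cases h : oplus a c = ⊤
  · rw [shift_of_eq h]
    exact ((conj_le_right a c).trans_lt (lt_top_iff_ne_top.2 hx)).ne
  · rwa [shift_of_ne h]

/-- The mixed case, where only `b + c` reaches the unit. Both orders give `m + 1` and the remainder
`a + b + c - 1`; `h3` identifies its two expressions. -/
lemma shift_shift_aux {m : ℕ} (h : oplus b c = ⊤) (h' : oplus a c ≠ ⊤) :
    shift a (shift b (m, c)) = shift b (shift a (m, c)) := by
  have h0 := conj_eq_bot_of_oplus_ne_top h'
  have hbc : compl b ≤ c := oplus_eq_top_iff.1 h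
  have hac : a ≤ compl c := conj_eq_bot_iff.1 h0
  have hab : a ≤ b := hac.trans (compl_le_comm.1 hbc)
  have h2 : oplus b (oplus a c) = ⊤ :=
    top_le_iff.1 (h.ge.trans (oplus_mono le_rfl (le_oplus_left _ _)))
  have hle : oplus a (conj b c) ≤ b :=
    calc oplus a (conj b c) ≤ oplus a (conj (compl a) b) := by
          rw [conj_comm b c]
          exact oplus_mono le_rfl (conj_mono (le_compl_comm.1 hac) le_rfl)
      _ = b := oplus_conj_compl hab
  have h3 : conj b (oplus a c) = oplus a (conj b c) := by
    conv_lhs => rw [← compl_oplus_conj hbc, oplus_left_comm]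
    have := conj_compl_oplus (a := compl b) (b := oplus a (conj b c)) (by simpa using hle)
    simpa using this
  have h4 : oplus a (conj b c) ≠ ⊤ := by
    rw [← h3]
    exact ((conj_le_right _ _).trans_lt (lt_top_iff_ne_top.2 h')).ne
  rw [shift_of_eq h, shift_of_ne h', shift_of_ne h4, shift_of_eq h2, h3]

lemma shift_shift_comm (a b : A) (x : ℕ × A) : shift a (shift b x) = shift b (shift a x) := by
  obtain ⟨m, c⟩ := x
  by_cases h : oplus b c = ⊤ <;> by_cases h' : oplus a c = ⊤
  · rw [shift_of_eq h, shift_of_eq h']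
    have hb : b = oplus (compl c) (conj b c) := by
      rw [conj_comm, compl_oplus_conj (compl_le_comm.1 (oplus_eq_top_iff.1 h))]
    have ha : a = oplus (compl c) (conj a c) := by
      rw [conj_comm, compl_oplus_conj (compl_le_comm.1 (oplus_eq_top_iff.1 h'))]
    -- By `ha` and `hb`, both sides are the truncated sum of `¬c`, `a * c` and `b * c`.
    have key : oplus a (conj b c) = oplus b (conj a c) := by
      conv_lhs => rw [ha]
      conv_rhs => rw [hb]
      rw [oplus_comm, oplus_left_comm, oplus_comm (conj b c), ← oplus_left_comm, oplus_comm]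
    by_cases h2 : oplus a (conj b c) = ⊤
    · rw [shift_of_eq h2, shift_of_eq (key ▸ h2), conj_left_comm]
    · rw [shift_of_ne h2, shift_of_ne (key ▸ h2), key]
  · exact shift_shift_aux h h'
  · exact (shift_shift_aux h' h).symm
  · rw [shift_of_ne h, shift_of_ne h']
    have hb : conj (compl c) (oplus b c) = b := by
      rw [oplus_comm]
      exact conj_compl_oplus (conj_eq_bot_iff.1 (conj_eq_bot_of_oplus_ne_top h))
    have ha : conj (compl c) (oplus a c) = a := by
      rw [oplus_comm]
      exact conj_compl_oplus (conj_eq_bot_iff.1 (conj_eq_bot_of_oplus_ne_top h'))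
    -- Dually, both sides are the product of `¬c`, `a ⊕ c` and `b ⊕ c`.
    have key : conj a (oplus b c) = conj b (oplus a c) := by
      conv_lhs => rw [← ha]
      conv_rhs => rw [← hb]
      rw [conj_assoc, conj_assoc, conj_comm (oplus a c)]
    by_cases h2 : oplus a (oplus b c) = ⊤
    · rw [shift_of_eq h2, shift_of_eq (oplus_left_comm a b c ▸ h2), key]
    · rw [shift_of_ne h2, shift_of_ne (oplus_left_comm a b c ▸ h2), oplus_left_comm]

/-- Addition in the group is cancellative. The condition `≠ ⊤` makes the representation unique, as
`(m, ⊤)` and `(m + 1, ⊥)` would be the same element. -/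
lemma shift_strictMono {x y : ℕ × A} (hx : x.2 ≠ ⊤) (hy : y.2 ≠ ⊤) (h : toLex x < toLex y) :
    toLex (shift a x) < toLex (shift a y) := by
  obtain ⟨m, c⟩ := x
  obtain ⟨n, d⟩ := y
  simp only [Prod.Lex.toLex_lt_toLex] at h hx hy ⊢
  have hconj : ∀ {p q : A}, p < q → oplus a p = ⊤ → conj a p < conj a q := by
    intro p q hpq hp
    refine lt_of_le_of_ne (conj_mono le_rfl hpq.le) fun heq => hpq.ne ?_
    have h1 : compl a ≤ p := oplus_eq_top_iff.1 hp
    rw [← res_conj h1, heq, res_conj (h1.trans hpq.le)]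
  have hoplus : ∀ {p q : A}, p < q → oplus a q ≠ ⊤ → oplus a p < oplus a q := by
    intro p q hpq hq
    refine lt_of_le_of_ne (oplus_mono le_rfl hpq.le) fun heq => hpq.ne ?_
    have h1 : q ≤ compl a := le_compl_comm.1 (conj_eq_bot_iff.1 (conj_eq_bot_of_oplus_ne_top hq))
    rw [← conj_compl_oplus h1, ← heq, conj_compl_oplus (hpq.le.trans h1)]
  by_cases h1 : oplus a c = ⊤ <;> by_cases h2 : oplus a d = ⊤
  · rw [shift_of_eq h1, shift_of_eq h2]
    rcases h with h | ⟨rfl, h⟩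
    · left; simpa using h
    · right; exact ⟨rfl, hconj h h1⟩
  · rw [shift_of_eq h1, shift_of_ne h2]
    rcases h with h | ⟨rfl, h⟩
    · rcases Nat.lt_or_eq_of_le (Nat.succ_le_of_lt h) with h | h
      · left; exact h
      -- Here `m + 1 = n`, and `a * c < a * ⊤ = a ≤ a ⊕ d`.
      · right
        refine ⟨h, lt_of_lt_of_le ?_ (le_oplus_right a d)⟩
        simpa [conj_top] using hconj (lt_top_iff_ne_top.2 hx) h1
    · exact absurd (top_le_iff.1 (h1.ge.trans (oplus_mono le_rfl h.le))) h2
  · rw [shift_of_ne h1, shift_of_eq h2]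
    left
    rcases h with h | ⟨rfl, h⟩
    · exact Nat.lt_succ_of_lt h
    · exact Nat.lt_succ_self m
  · rw [shift_of_ne h1, shift_of_ne h2]
    rcases h with h | ⟨rfl, h⟩
    · left; exact h
    · right; exact ⟨rfl, hoplus h h2⟩

instance : LeftCommutative (shift (A := A)) := ⟨shift_shift_comm⟩

/-- The sum of a multiset of elements of a chain, in its ordered group. -/
noncomputable def total (s : Multiset A) : ℕ × A := s.foldr shift (0, ⊥)

lemma total_zero : total (0 : Multiset A) = (0, ⊥) := rfl

lemma total_cons (a : A) (s : Multiset A) : total (a ::ₘ s) = shift a (total s) :=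
  Multiset.foldr_cons ..

/-- Comparison of sums in the ordered group of a chain. -/
def SumLE (s t : Multiset A) : Prop := toLex (total s) ≤ toLex (total t)

lemma SumLE.refl (s : Multiset A) : SumLE s s := le_refl (toLex (total s))

lemma SumLE.trans {r s t : Multiset A} (h : SumLE r s) (h' : SumLE s t) : SumLE r t :=
  le_trans (α := ℕ ×ₗ A) h h'

lemma sumLE_total (s t : Multiset A) : SumLE s t ∨ SumLE t s :=
  le_total (α := ℕ ×ₗ A) _ _

lemma total_singleton (h : a ≠ ⊤) : total {a} = (0, a) := by
  rw [← Multiset.cons_zero, total_cons, total_zero, shift_of_ne (by rwa [oplus_bot]), oplus_bot]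

lemma total_top : total {(⊤ : A)} = (1, ⊥) := by
  rw [← Multiset.cons_zero, total_cons, total_zero, shift_of_eq (by rw [oplus_bot]), top_conj]

lemma zero_sumLE (s : Multiset A) : SumLE 0 s := by
  rw [SumLE, total_zero, Prod.Lex.toLex_le_toLex]
  rcases Nat.eq_zero_or_pos (total s).1 with h | h
  · right; exact ⟨h.symm, bot_le⟩
  · left; exact h

lemma sumLE_singleton_iff : SumLE {a} {b} ↔ a ≤ b := by
  rw [SumLE, Prod.Lex.toLex_le_toLex]
  by_cases ha : a = ⊤ <;> by_cases hb : b = ⊤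
  · simp [ha, hb]
  · rw [ha, total_top, total_singleton hb]
    simp [hb]
  · rw [hb, total_top, total_singleton ha]
    simp
  · rw [total_singleton ha, total_singleton hb]
    simp

/-- The linear form of strong conjunction where it is not truncated: `a * b + 1 = a + b`. -/
lemma total_pair (h : oplus a b = ⊤) : total {conj a b, ⊤} = total {a, b} := by
  by_cases hb : b = ⊤
  · rw [hb, conj_top]
  · rw [Multiset.insert_eq_cons, ← Multiset.cons_zero, Multiset.cons_swap, Multiset.insert_eq_cons,
      Multiset.cons_zero, total_cons, total_cons, total_singleton hb, shift_of_eq h,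
      total_singleton ((conj_le_right a b).trans_lt (lt_top_iff_ne_top.2 hb)).ne,
      shift_of_eq (top_le_iff.1 (le_oplus_right _ _)), top_conj]

lemma pair_sumLE_top (h : oplus a b ≠ ⊤) : SumLE {a, b} {⊤} := by
  have hb : b ≠ ⊤ := by
    rintro rfl
    exact h (top_le_iff.1 (le_oplus_left _ _))
  rw [SumLE, Multiset.insert_eq_cons, total_cons, total_singleton hb, shift_of_ne h, total_top,
    Prod.Lex.toLex_le_toLex]
  left
  exact Nat.zero_lt_one

variable [Nontrivial A]

lemma total_snd_ne_top (s : Multiset A) : (total s).2 ≠ ⊤ := by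
  induction s using Multiset.induction_on with
  | empty => exact bot_ne_top
  | cons a s ih =>
    rw [total_cons]
    exact shift_snd_ne_top ih

lemma sumLE_cons_iff {s t : Multiset A} : SumLE (a ::ₘ s) (a ::ₘ t) ↔ SumLE s t := by
  have key : ∀ s t : Multiset A, ¬ SumLE s t → ¬ SumLE (a ::ₘ s) (a ::ₘ t) := by
    intro s t h
    rw [SumLE, not_le] at h ⊢
    rw [total_cons, total_cons]
    exact shift_strictMono (total_snd_ne_top t) (total_snd_ne_top s) h
  refine ⟨fun h => by_contra fun h' => key s t h' h, fun h => ?_⟩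
  by_cases h' : SumLE t s
  · have : total s = total t := toLex.injective (le_antisymm (α := ℕ ×ₗ A) h h')
    rw [SumLE, total_cons, total_cons, this]
  · exact (sumLE_total _ _).resolve_right (key t s h')

lemma sumLE_add_left_iff {r s t : Multiset A} : SumLE (r + s) (r + t) ↔ SumLE s t := by
  induction r using Multiset.induction_on with
  | empty => simp
  | cons a r ih => rw [Multiset.cons_add, Multiset.cons_add, sumLE_cons_iff, ih]

lemma SumLE.add {s t s' t' : Multiset A} (h : SumLE s t) (h' : SumLE s' t') :
    SumLE (s + s') (t + t') := by
  refine SumLE.trans (sumLE_add_left_iff.2 h') ?_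
  rw [add_comm s, add_comm t]
  exact sumLE_add_left_iff.2 h

lemma SumLE.nsmul {s t : Multiset A} (h : SumLE s t) (n : ℕ) : SumLE (n • s) (n • t) := by
  induction n with
  | zero => simpa using SumLE.refl 0
  | succ n ih => simpa only [succ_nsmul] using ih.add h

lemma SumLE.sum {ι : Type*} (J : Finset ι) {s t : ι → Multiset A} (h : ∀ i ∈ J, SumLE (s i) (t i)) :
    SumLE (∑ i ∈ J, s i) (∑ i ∈ J, t i) := by
  classical
  induction J using Finset.induction_on with
  | empty => simpa using SumLE.refl 0
  | insert i J hi ih =>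
    rw [Finset.sum_insert hi, Finset.sum_insert hi]
    exact (h i (by simp)).add (ih fun j hj => h j (by simp [hj]))

/-- A linearly ordered group is torsion-free: from `s ≤ t` and `(k+1)t ≤ (k+1)s` one gets `ks + t ≤
kt + t ≤ ks + s`, and `ks` cancels. -/
lemma not_sumLE_nsmul {s t : Multiset A} (h : ¬ SumLE t s) {n : ℕ} (hn : n ≠ 0) :
    ¬ SumLE (n • t) (n • s) := by
  obtain ⟨k, rfl⟩ := Nat.exists_eq_succ_of_ne_zero hn
  intro h1
  have h2 := ((sumLE_total t s).resolve_left h).nsmul k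
  have h3 := sumLE_add_left_iff (r := k • s) |>.not.2 h
  apply h3
  refine SumLE.trans (t := k • s + s) (s := k • t + t) ?_ ?_
  · rw [add_comm _ t, add_comm _ t]
    exact sumLE_add_left_iff.2 h2
  · simpa only [Nat.succ_eq_add_one, succ_nsmul] using h1

lemma bot_sumLE_zero : SumLE {(⊥ : A)} 0 := by
  rw [SumLE, total_zero, total_singleton bot_ne_top]

end Chain

end MVAlgebra

/-! ### Łukasiewicz theories and their Lindenbaum algebras. -/

open Fm

/-- Sets of formulas that contain the Łukasiewicz axioms and are closed under Modus Ponens. -/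
class IsLukTheory (F : Set Fm) : Prop where
  luk {φ : Fm} : LukAxiom φ → φ ∈ F
  mp {φ ψ : Fm} : φ ∈ F → φ ⇒ ψ ∈ F → ψ ∈ F

namespace IsLukTheory

variable {F : Set Fm} [IsLukTheory F] {a b c d : Fm}

lemma imp_trans (h : a ⇒ b ∈ F) (h' : b ⇒ c ∈ F) : a ⇒ c ∈ F :=
  mp h' (mp h (luk (.trans a b c)))

lemma imp_imp_iff : a ⇒ b ⇒ c ∈ F ↔ (a ⊛ b) ⇒ c ∈ F :=
  ⟨fun h => mp h (luk (.uncurry a b c)), fun h => mp h (luk (.curry a b c))⟩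

lemma imp_of_mem (h : a ∈ F) (b : Fm) : b ⇒ a ∈ F :=
  mp h (imp_imp_iff.2 (luk (.weak a b)))

lemma imp_refl (F : Set Fm) [IsLukTheory F] (a : Fm) : a ⇒ a ∈ F := by
  have h : (bot ⇒ bot) ⇒ a ⇒ a ∈ F :=
    imp_imp_iff.2 (imp_trans (luk (.comm _ _)) (luk (.weak _ _)))
  exact mp (luk (.exfalso bot)) h

lemma imp_swap (h : a ⇒ b ⇒ c ∈ F) : b ⇒ a ⇒ c ∈ F :=
  imp_imp_iff.2 (imp_trans (luk (.comm _ _)) (imp_imp_iff.1 h))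

lemma conj_mono_left (h : a ⇒ b ∈ F) (c : Fm) : (a ⊛ c) ⇒ (b ⊛ c) ∈ F :=
  imp_imp_iff.1 (imp_trans h (imp_imp_iff.2 (imp_refl F _)))

lemma conj_mono (h : a ⇒ b ∈ F) (h' : c ⇒ d ∈ F) : (a ⊛ c) ⇒ (b ⊛ d) ∈ F :=
  imp_trans (conj_mono_left h c)
    (imp_trans (luk (.comm _ _)) (imp_trans (conj_mono_left h' b) (luk (.comm _ _))))

lemma imp_mono (h : b ⇒ a ∈ F) (h' : c ⇒ d ∈ F) : (a ⇒ c) ⇒ (b ⇒ d) ∈ F :=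
  imp_imp_iff.2 (imp_trans (conj_mono (imp_refl F _) h)
    (imp_trans (imp_imp_iff.1 (imp_refl F _)) h'))

lemma conj_assoc_imp (a b c : Fm) : ((a ⊛ b) ⊛ c) ⇒ (a ⊛ (b ⊛ c)) ∈ F :=
  imp_imp_iff.1 (imp_imp_iff.1
    (imp_trans (imp_imp_iff.2 (imp_refl F _)) (luk (.curry b c _))))

lemma imp_conj_assoc (a b c : Fm) : (a ⊛ (b ⊛ c)) ⇒ ((a ⊛ b) ⊛ c) ∈ F :=
  imp_imp_iff.1 (imp_trans (imp_imp_iff.2 (imp_imp_iff.2 (imp_refl F _))) (luk (.uncurry b c _)))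

lemma isLukTheory_sUnion {C : Set (Set Fm)} (hC : IsChain (· ⊆ ·) C) (hne : C.Nonempty)
    (h : ∀ F ∈ C, IsLukTheory F) : IsLukTheory (⋃₀ C) where
  luk hφ := by
    obtain ⟨F, hF⟩ := hne
    exact ⟨F, hF, (h F hF).luk hφ⟩
  mp := by
    rintro φ ψ ⟨F, hF, h1⟩ ⟨G, hG, h2⟩
    rcases hC.total hF hG with hFG | hFG
    · exact ⟨G, hG, (h G hG).mp (hFG h1) h2⟩
    · exact ⟨F, hF, (h F hF).mp h1 (hFG h2)⟩

end IsLukTheory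

/-- Powers with respect to strong conjunction. -/
def Fm.pow (a : Fm) : ℕ → Fm
  | 0 => bot ⇒ bot
  | n + 1 => Fm.pow a n ⊛ a

/-- The least Łukasiewicz theory that contains `F` and `a`. -/
def adjoin (F : Set Fm) (a : Fm) : Set Fm := {c | ∃ n, Fm.pow a n ⇒ c ∈ F}

namespace IsLukTheory

variable {F : Set Fm} [IsLukTheory F] {a b c d : Fm}

lemma pow_add_imp (a : Fm) (m n : ℕ) : Fm.pow a (m + n) ⇒ (Fm.pow a m ⊛ Fm.pow a n) ∈ F := by
  induction n with
  | zero =>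
    refine imp_trans (mp (luk (.exfalso bot)) (imp_swap (imp_imp_iff.2 (imp_refl F _)))) ?_
    exact imp_refl F _
  | succ n ih => exact imp_trans (conj_mono_left ih a) (conj_assoc_imp _ _ _)

/-- Contraction fails, so the exponent counts the uses of `a`, and Modus Ponens adds exponents. -/
instance isLukTheory_adjoin (a : Fm) : IsLukTheory (adjoin F a) where
  luk h := ⟨0, imp_of_mem (luk h) _⟩
  mp := by
    rintro φ ψ ⟨m, h1⟩ ⟨n, h2⟩
    exact ⟨n + m, imp_trans (pow_add_imp a n m)
      (imp_trans (conj_mono h2 h1) (imp_imp_iff.1 (imp_refl F _)))⟩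

lemma subset_adjoin (a : Fm) : F ⊆ adjoin F a := fun _ h => ⟨0, imp_of_mem h _⟩

lemma mem_adjoin (a : Fm) : a ∈ adjoin F a :=
  ⟨1, imp_trans (luk (.comm _ _)) (luk (.weak _ _))⟩

/-- Proof by cases extends from `a` to its powers: one factor `a` is removed by applying the case
rule to `aⁿ → c`. -/
lemma of_pow_imp (h : ∀ c, a ⇒ c ∈ F → b ⇒ c ∈ F → c ∈ F) (n : ℕ) :
    ∀ c, Fm.pow a n ⇒ c ∈ F → b ⇒ c ∈ F → c ∈ F := by
  induction n with
  | zero => exact fun c h1 _ => mp (luk (.exfalso bot)) h1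
  | succ n ih =>
    intro c h1 h2
    exact ih c (h _ (imp_swap (imp_imp_iff.2 h1)) (imp_trans h2 (imp_imp_iff.2 (luk (.weak _ _))))) h2

/-- Prelinearity: a formula that follows from `a ⇒ b` and from `b ⇒ a` is in the theory. -/
lemma mem_of_mem_adjoin (h : c ∈ adjoin F (a ⇒ b)) (h' : c ∈ adjoin F (b ⇒ a)) : c ∈ F := by
  obtain ⟨m, h⟩ := h
  obtain ⟨n, h'⟩ := h'
  have h0 : ∀ c, (a ⇒ b) ⇒ c ∈ F → (b ⇒ a) ⇒ c ∈ F → c ∈ F :=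
    fun c h1 h2 => mp h2 (mp h1 (luk (.prelin a b c)))
  have h1 := of_pow_imp h0 m
  exact of_pow_imp (fun c h2 h3 => h1 c h3 h2) n c h' h

variable (F) in
/-- Provable equivalence over a theory. -/
def setoid : Setoid Fm where
  r a b := a ⇒ b ∈ F ∧ b ⇒ a ∈ F
  iseqv := ⟨fun a => ⟨imp_refl F a, imp_refl F a⟩, fun h => ⟨h.2, h.1⟩,
    fun h h' => ⟨imp_trans h.1 h'.1, imp_trans h'.2 h.2⟩⟩

end IsLukTheory

open IsLukTheory

/-- The Lindenbaum algebra of a theory. -/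
def Lind (F : Set Fm) [IsLukTheory F] : Type := Quotient (IsLukTheory.setoid F)

namespace Lind

variable {F : Set Fm} [IsLukTheory F]

variable (F) in
/-- The class of a formula. -/
def mk (a : Fm) : Lind F := Quotient.mk (IsLukTheory.setoid F) a

lemma mk_eq_mk {a b : Fm} : mk F a = mk F b ↔ a ⇒ b ∈ F ∧ b ⇒ a ∈ F := Quotient.eq

instance : PartialOrder (Lind F) where
  le x y := Quotient.liftOn₂ x y (fun a b => a ⇒ b ∈ F) fun _ _ _ _ h h' => propext
    ⟨fun h0 => imp_trans h.2 (imp_trans h0 h'.1), fun h0 => imp_trans h.1 (imp_trans h0 h'.2)⟩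
  le_refl := Quotient.ind fun a => imp_refl F a
  le_trans := by
    rintro ⟨a⟩ ⟨b⟩ ⟨c⟩ h h'
    exact imp_trans (F := F) (a := a) (b := b) (c := c) h h'
  le_antisymm := by
    rintro ⟨a⟩ ⟨b⟩ h h'
    exact Quotient.sound ⟨h, h'⟩

lemma mk_le_mk {a b : Fm} : mk F a ≤ mk F b ↔ a ⇒ b ∈ F := Iff.rfl

instance : BoundedOrder (Lind F) where
  top := mk F (bot ⇒ bot)
  le_top := by
    rintro ⟨a⟩
    exact mk_le_mk.2 (imp_of_mem (luk (.exfalso bot)) a)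
  bot := mk F bot
  bot_le := by
    rintro ⟨a⟩
    exact mk_le_mk.2 (luk (.exfalso a))

lemma mk_eq_top_iff {a : Fm} : mk F a = ⊤ ↔ a ∈ F := by
  rw [← top_le_iff]
  exact ⟨fun h => mp (luk (.exfalso bot)) (mk_le_mk.1 h), fun h => mk_le_mk.2 (imp_of_mem h _)⟩

instance : MVAlgebra (Lind F) where
  conj := Quotient.map₂ (· ⊛ ·) fun _ _ h _ _ h' => ⟨conj_mono h.1 h'.1, conj_mono h.2 h'.2⟩
  res := Quotient.map₂ (· ⇒ ·) fun _ _ h _ _ h' => ⟨imp_mono h.2 h'.1, imp_mono h.1 h'.2⟩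
  conj_comm := by
    rintro ⟨a⟩ ⟨b⟩
    exact mk_eq_mk.2 ⟨luk (.comm _ _), luk (.comm _ _)⟩
  conj_assoc := by
    rintro ⟨a⟩ ⟨b⟩ ⟨c⟩
    exact mk_eq_mk.2 ⟨conj_assoc_imp _ _ _, imp_conj_assoc _ _ _⟩
  top_conj := by
    rintro ⟨a⟩
    exact mk_eq_mk.2 ⟨imp_trans (luk (.comm _ _)) (luk (.weak _ _)),
      mp (luk (.exfalso bot)) (imp_imp_iff.2 (imp_refl F _))⟩
  le_res_iff := by
    rintro ⟨a⟩ ⟨b⟩ ⟨c⟩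
    exact imp_imp_iff (F := F) (a := a) (b := b) (c := c)
  conj_res_comm := by
    rintro ⟨a⟩ ⟨b⟩
    exact mk_eq_mk.2 ⟨luk (.divis _ _), luk (.divis _ _)⟩
  res_res_bot := by
    rintro ⟨a⟩
    exact mk_eq_mk.2 ⟨luk (.dneg a), imp_swap (imp_refl F _)⟩

lemma mk_imp (a b : Fm) : mk F (a ⇒ b) = MVAlgebra.res (mk F a) (mk F b) := rfl

end Lind

/-- Prime theories, whose Lindenbaum algebras are nontrivial chains. -/
class IsPrimeTheory (F : Set Fm) : Prop extends IsLukTheory F where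
  total (a b : Fm) : a ⇒ b ∈ F ∨ b ⇒ a ∈ F
  bot_notMem : bot ∉ F

namespace Lind

variable {F : Set Fm} [IsPrimeTheory F]

noncomputable instance : LinearOrder (Lind F) where
  __ := (inferInstance : PartialOrder (Lind F))
  le_total := by
    rintro ⟨a⟩ ⟨b⟩
    exact IsPrimeTheory.total a b
  toDecidableLE := Classical.decRel _

instance : Nontrivial (Lind F) :=
  ⟨mk F bot, ⊤, fun h => IsPrimeTheory.bot_notMem (mk_eq_top_iff.1 h)⟩

end Lind

/-! ### Linear inequalities over an ordered field. -/

/-- **Farkas' lemma** for finitely many linear functionals over an ordered field. -/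
lemma farkas {K W ι : Type*} [Field K] [LinearOrder K] [IsStrictOrderedRing K] [AddCommGroup W]
    [Module K W] (J : Finset ι) (A : ι → W →ₗ[K] K) (γ : W →ₗ[K] K)
    (h : ∀ x, (∀ i ∈ J, A i x ≤ 0) → γ x ≤ 0) :
    ∃ l : ι → K, (∀ i, 0 ≤ l i) ∧ γ = ∑ i ∈ J, l i • A i := by
  classical
  induction J using Finset.induction_on generalizing A γ with
  | empty =>
    refine ⟨0, fun _ => le_rfl, LinearMap.ext fun x => le_antisymm (h x (by simp)) ?_⟩
    simpa using h (-x) (by simp)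
  | insert j J hj ih =>
    by_cases h0 : ∀ x, (∀ i ∈ J, A i x ≤ 0) → γ x ≤ 0
    · obtain ⟨l, hl, hγ⟩ := ih A γ h0
      refine ⟨Function.update l j 0, fun i => ?_, ?_⟩
      · by_cases hi : i = j
        · simp [hi]
        · simp [hi, hl i]
      · rw [Finset.sum_insert hj, Function.update_self, zero_smul, zero_add, hγ]
        refine Finset.sum_congr rfl fun i hi => ?_
        rw [Function.update_of_ne (by rintro rfl; exact hj hi)]
    · push Not at h0
      obtain ⟨y, hy, hγy⟩ := h0
      have hjy : 0 < A j y := by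
        by_contra! hle
        refine hγy.not_ge (h y fun i hi => ?_)
        rcases Finset.mem_insert.1 hi with rfl | hi
        · exact hle
        · exact hy i hi
      -- Scaling `y` makes `x ↦ x - A j x • z` a projection onto the kernel of `A j`; the induction
      -- hypothesis is applied to the functionals composed with it.
      obtain ⟨z, hz, hγz, hjz⟩ : ∃ z, (∀ i ∈ J, A i z ≤ 0) ∧ 0 < γ z ∧ A j z = 1 := by
        refine ⟨(A j y)⁻¹ • y, fun i hi => ?_, ?_, ?_⟩
        · rw [map_smul, smul_eq_mul]
          exact mul_nonpos_of_nonneg_of_nonpos (inv_nonneg.2 hjy.le) (hy i hi)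
        · rw [map_smul, smul_eq_mul]
          exact mul_pos (inv_pos.2 hjy) hγy
        · rw [map_smul, smul_eq_mul, inv_mul_cancel₀ hjy.ne']
      obtain ⟨l, hl, hγ⟩ := ih (fun i => A i - A i z • A j) (γ - γ z • A j) fun x hx => by
        have h1 := h (x - A j x • z) fun i hi => by
          rcases Finset.mem_insert.1 hi with rfl | hi
          · simp [hjz]
          · have := hx i hi
            simp only [LinearMap.sub_apply, LinearMap.smul_apply, smul_eq_mul] at this
            simpa [mul_comm] using this
        simp only [LinearMap.sub_apply, LinearMap.smul_apply, smul_eq_mul]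
        simpa [mul_comm] using h1
      -- This coefficient is forced by evaluation at `z`; it is nonnegative because `γ z > 0` and
      -- all `A i z ≤ 0`.
      refine ⟨Function.update l j (γ z - ∑ i ∈ J, l i * A i z), fun i => ?_, ?_⟩
      · by_cases hi : i = j
        · subst hi
          rw [Function.update_self, sub_nonneg]
          exact (Finset.sum_nonpos fun k hk =>
            mul_nonpos_of_nonneg_of_nonpos (hl k) (hz k hk)).trans hγz.le
        · simp [hi, hl i]
      · rw [Finset.sum_insert hj, Function.update_self]
        have h1 : ∑ i ∈ J, Function.update l j (γ z - ∑ i ∈ J, l i * A i z) i • A i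
            = ∑ i ∈ J, l i • A i := Finset.sum_congr rfl fun i hi => by
          rw [Function.update_of_ne (by rintro rfl; exact hj hi)]
        rw [h1]
        refine LinearMap.ext fun x => ?_
        have h2 := LinearMap.congr_fun hγ x
        have h3 : ∑ i ∈ J, l i * (A i z * A j x) = (∑ i ∈ J, l i * A i z) * A j x := by
          simp only [Finset.sum_mul, mul_assoc]
        simp only [LinearMap.sub_apply, LinearMap.add_apply, LinearMap.smul_apply,
          LinearMap.sum_apply, smul_eq_mul, mul_sub, Finset.sum_sub_distrib, h3] at h2 ⊢
        linear_combination h2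

/-- Nonnegative rationals have a common denominator. -/
lemma exists_common_denominator {ι : Type*} (J : Finset ι) (l : ι → ℚ) (hl : ∀ i, 0 ≤ l i) :
    ∃ N : ℕ, N ≠ 0 ∧ ∀ i ∈ J, ∃ n : ℕ, (N : ℚ) * l i = n := by
  classical
  refine ⟨∏ i ∈ J, (l i).den, Finset.prod_ne_zero_iff.2 fun i _ => (l i).den_nz, fun i hi => ?_⟩
  rw [← Finset.prod_erase_mul _ _ hi]
  refine ⟨(∏ k ∈ J.erase i, (l k).den) * (l i).num.toNat, ?_⟩
  have h1 : ((l i).num.toNat : ℚ) = (l i).num := by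
    exact_mod_cast congrArg (Int.cast : ℤ → ℚ) (Int.toNat_of_nonneg (Rat.num_nonneg.2 (hl i)))
  have h2 : ((l i).den : ℚ) * l i = (l i).num := by
    rw [mul_comm]
    exact Rat.mul_den_eq_num _
  push_cast
  rw [h1, mul_assoc, h2]

/-! ### Sums of formulas and their transfer between prime theories. -/

open Fm MVAlgebra Lind

/-- Comparison of sums of formulas in the ordered group of the Lindenbaum algebra. -/
def FmSumLE (F : Set Fm) [IsPrimeTheory F] (s t : Multiset Fm) : Prop :=
  SumLE (s.map (mk F)) (t.map (mk F))

namespace FmSumLE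

variable {F : Set Fm} [IsPrimeTheory F] {r s t : Multiset Fm}

lemma add_left_iff : FmSumLE F (r + s) (r + t) ↔ FmSumLE F s t := by
  rw [FmSumLE, Multiset.map_add, Multiset.map_add, sumLE_add_left_iff, FmSumLE]

lemma add_right_iff : FmSumLE F (s + r) (t + r) ↔ FmSumLE F s t := by
  rw [add_comm s, add_comm t, add_left_iff]

lemma nsmul (h : FmSumLE F s t) (n : ℕ) : FmSumLE F (n • s) (n • t) := by
  rw [FmSumLE, Multiset.map_nsmul, Multiset.map_nsmul]
  exact SumLE.nsmul h n

lemma sum {ι : Type*} (J : Finset ι) {s t : ι → Multiset Fm} (h : ∀ i ∈ J, FmSumLE F (s i) (t i)) :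
    FmSumLE F (∑ i ∈ J, s i) (∑ i ∈ J, t i) := by
  rw [FmSumLE, ← Multiset.coe_mapAddMonoidHom, map_sum, map_sum]
  exact SumLE.sum J h

lemma not_nsmul (h : ¬ FmSumLE F t s) {n : ℕ} (hn : n ≠ 0) : ¬ FmSumLE F (n • t) (n • s) := by
  rw [FmSumLE, Multiset.map_nsmul, Multiset.map_nsmul]
  exact not_sumLE_nsmul h hn

lemma singleton_iff {a b : Fm} : FmSumLE F {a} {b} ↔ a ⇒ b ∈ F := by
  rw [FmSumLE, Multiset.map_singleton, Multiset.map_singleton, sumLE_singleton_iff, mk_le_mk]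

end FmSumLE

lemma isModalComb_neg {a : Fm} (h : IsModalComb a) : IsModalComb (neg a) := .imp h .bot

lemma isModalComb_top : IsModalComb (bot ⇒ bot) := .imp .bot .bot

/-- Each carry in the sum is decided by membership of a modal combination, and the remainder is
again a modal combination; so the same computation runs in both chains. -/
lemma exists_total_eq {F G : Set Fm} [IsPrimeTheory F] [IsPrimeTheory G]
    (h : ∀ ν, IsModalComb ν → (ν ∈ F ↔ ν ∈ G)) (s : Multiset Fm) (hs : ∀ a ∈ s, IsModalComb a) :
    ∃ m c, IsModalComb c ∧ total (s.map (mk F)) = (m, mk F c) ∧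
      total (s.map (mk G)) = (m, mk G c) := by
  induction s using Multiset.induction_on with
  | empty => exact ⟨0, bot, .bot, rfl, rfl⟩
  | cons a s ih =>
    obtain ⟨m, c, hc, h1, h2⟩ := ih fun b hb => hs b (Multiset.mem_cons_of_mem hb)
    have ha := hs a (Multiset.mem_cons_self a s)
    have hac : IsModalComb (neg a ⇒ c) := .imp (isModalComb_neg ha) hc
    rw [Multiset.map_cons, Multiset.map_cons, total_cons, total_cons, h1, h2]
    by_cases hF : neg a ⇒ c ∈ F
    · exact ⟨m + 1, a ⊛ c, .conj ha hc, shift_of_eq (mk_eq_top_iff.2 hF),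
        shift_of_eq (mk_eq_top_iff.2 ((h _ hac).1 hF))⟩
    · exact ⟨m, neg a ⇒ c, hac, shift_of_ne fun h0 => hF (mk_eq_top_iff.1 h0),
        shift_of_ne fun h0 => hF ((h _ hac).2 (mk_eq_top_iff.1 h0))⟩

/-- Comparisons between sums of modal combinations depend only on the modal combinations in the
theory. -/
lemma FmSumLE.congr {F G : Set Fm} [IsPrimeTheory F] [IsPrimeTheory G]
    (h : ∀ ν, IsModalComb ν → (ν ∈ F ↔ ν ∈ G)) {s t : Multiset Fm}
    (hs : ∀ a ∈ s, IsModalComb a) (ht : ∀ a ∈ t, IsModalComb a) (hst : FmSumLE F s t) :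
    FmSumLE G s t := by
  obtain ⟨m, c, hc, h1, h2⟩ := exists_total_eq h s hs
  obtain ⟨n, d, hd, h3, h4⟩ := exists_total_eq h t ht
  rw [FmSumLE, SumLE, h1, h3, Prod.Lex.toLex_le_toLex] at hst
  rw [FmSumLE, SumLE, h2, h4, Prod.Lex.toLex_le_toLex]
  refine hst.imp id (And.imp id fun h0 => ?_)
  exact mk_le_mk.2 ((h _ (.imp hc hd)).1 (mk_le_mk.1 h0))

/-! ### Simultaneous rational values for several chains. -/

section Weights

open Classical

variable {X : Type*}

/-- The variable that stands for the value of a formula at a world; modal combinations have the same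
value at all worlds. -/
noncomputable def key (x : X) (a : Fm) : Fm ⊕ X × Fm :=
  if IsModalComb a then .inl a else .inr (x, a)

lemma count_inl_map_key (x : X) (a : Fm) (s : Multiset Fm) :
    (s.map (key x)).count (.inl a) = (s.filter IsModalComb).count a := by
  induction s using Multiset.induction_on with
  | empty => simp
  | cons b s ih =>
    by_cases hb : IsModalComb b
    · simp [key, hb, Multiset.count_cons, ih]
    · simp [key, hb, ih]

lemma count_inr_map_key (x y : X) (a : Fm) (s : Multiset Fm) :
    (s.map (key y)).count (.inr (x, a)) =
      if y = x then (s.filter (¬ IsModalComb ·)).count a else 0 := by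
  induction s using Multiset.induction_on with
  | empty => simp
  | cons b s ih =>
    by_cases hb : IsModalComb b
    · simp [key, hb, ih]
    · rw [Multiset.map_cons, Multiset.count_cons, ih]
      by_cases hyx : y = x
      · simp [key, hb, Multiset.count_cons, hyx]
      · simp [key, hb, hyx, Ne.symm hyx]

/-- The functional that adds up the coordinates in a multiset. -/
def sumCoord {K : Type*} (s : Multiset K) : (K → ℚ) →ₗ[ℚ] ℚ :=
  (s.map fun k => LinearMap.proj k).sum

lemma sumCoord_apply {K : Type*} (s : Multiset K) (f : K → ℚ) : sumCoord s f = (s.map f).sum := by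
  induction s using Multiset.induction_on with
  | empty => simp [sumCoord]
  | cons a s ih =>
    rw [Multiset.map_cons, Multiset.sum_cons, ← ih]
    simp [sumCoord]

lemma sumCoord_single {K : Type*} [DecidableEq K] (s : Multiset K) (k : K) :
    sumCoord s (Pi.single k 1) = s.count k := by
  induction s using Multiset.induction_on with
  | empty => simp [sumCoord]
  | cons a s ih =>
    rw [sumCoord_apply] at ih ⊢
    rw [Multiset.map_cons, Multiset.sum_cons, ih, Multiset.count_cons, Pi.single_apply]
    by_cases h : a = k
    · simp [h, add_comm]
    · simp [h, Ne.symm h]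

variable {F : X → Set Fm} [∀ x, IsPrimeTheory (F x)]

/-- Valid inequalities in Lindenbaum chains that share their modal combinations cannot be combined
into a contradiction. -/
lemma fmSumLE_of_count_eq (hF : ∀ x y ν, IsModalComb ν → (ν ∈ F x ↔ ν ∈ F y)) {ι : Type*}
    (J : Finset ι) (p : ι → X) (s t : ι → Multiset Fm)
    (hJ : ∀ j ∈ J, FmSumLE (F (p j)) (s j) (t j)) (N : ℕ) (n : ι → ℕ) (u v : Multiset Fm)
    (hl : ∀ x a, ∑ j ∈ J, n j * ((s j).map (key (p j))).count (.inr (x, a)) =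
      ∑ j ∈ J, n j * ((t j).map (key (p j))).count (.inr (x, a)))
    (hm : ∀ a, N * v.count a + ∑ j ∈ J, n j * ((t j).map (key (p j))).count (.inl a) =
      N * u.count a + ∑ j ∈ J, n j * ((s j).map (key (p j))).count (.inl a)) (x₀ : X) :
    FmSumLE (F x₀) (N • v) (N • u) := by
  have hx : ∀ x, FmSumLE (F x₀) (∑ j ∈ J with p j = x, n j • (s j).filter IsModalComb)
      (∑ j ∈ J with p j = x, n j • (t j).filter IsModalComb) := by
    intro x
    have h1 : FmSumLE (F x) (∑ j ∈ J with p j = x, n j • s j) (∑ j ∈ J with p j = x, n j • t j) :=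
      FmSumLE.sum _ fun j hj => by
        obtain ⟨hj', rfl⟩ := Finset.mem_filter.1 hj
        exact (hJ j hj').nsmul _
    have h2 : ∀ s : ι → Multiset Fm, ∑ j ∈ J with p j = x, n j • s j =
        ∑ j ∈ J with p j = x, n j • (s j).filter IsModalComb +
          ∑ j ∈ J with p j = x, n j • (s j).filter (¬ IsModalComb ·) := fun s => by
      rw [← Finset.sum_add_distrib]
      exact Finset.sum_congr rfl fun j _ => by rw [← nsmul_add, Multiset.filter_add_not]
    -- Unknowns indexed by `x` occur only in inequalities at `x`, so the balance `hl` already holds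
    -- within this world and the non-modal parts cancel.
    have h3 : ∑ j ∈ J with p j = x, n j • (s j).filter (¬ IsModalComb ·) =
        ∑ j ∈ J with p j = x, n j • (t j).filter (¬ IsModalComb ·) := by
      refine Multiset.ext.2 fun a => ?_
      have := hl x a
      simp only [count_inr_map_key, mul_ite, mul_zero, ← Finset.sum_filter] at this
      simpa only [Multiset.count_sum', Multiset.count_nsmul] using this
    rw [h2, h2 t, h3, FmSumLE.add_right_iff] at h1
    have h4 : ∀ s : ι → Multiset Fm,
        ∀ a ∈ ∑ j ∈ J with p j = x, n j • (s j).filter IsModalComb, IsModalComb a := by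
      intro s a ha
      obtain ⟨j, -, hj⟩ := Multiset.mem_sum.1 ha
      exact (Multiset.mem_filter.1 (Multiset.mem_of_mem_nsmul hj)).2
    exact h1.congr (hF x x₀) (h4 s) (h4 t)
  -- All modal remainders now live in the chain of `x₀` and can be added there.
  have h1 := FmSumLE.sum (J.image p) fun x _ => hx x
  rw [Finset.sum_fiberwise_of_maps_to fun j hj => Finset.mem_image_of_mem p hj,
    Finset.sum_fiberwise_of_maps_to fun j hj => Finset.mem_image_of_mem p hj] at h1
  have h2 : N • v + ∑ j ∈ J, n j • (t j).filter IsModalComb =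
      N • u + ∑ j ∈ J, n j • (s j).filter IsModalComb := by
    refine Multiset.ext.2 fun a => ?_
    simpa only [Multiset.count_add, Multiset.count_sum', Multiset.count_nsmul,
      count_inl_map_key] using hm a
  rw [← FmSumLE.add_right_iff (r := ∑ j ∈ J, n j • (t j).filter IsModalComb), h2,
    FmSumLE.add_left_iff]
  exact h1

/-- Finitely many comparisons of sums that hold in Lindenbaum chains with common modal combinations
are realized by rational values, in which a given modal combination is not the top. -/
theorem exists_rational_values (hF : ∀ x y ν, IsModalComb ν → (ν ∈ F x ↔ ν ∈ F y)) {ι : Type*}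
    (J : Finset ι) (p : ι → X) (s t : ι → Multiset Fm)
    (hJ : ∀ j ∈ J, FmSumLE (F (p j)) (s j) (t j)) {ν : Fm} (hν : IsModalComb ν) (x₀ : X)
    (hν' : ν ∉ F x₀) :
    ∃ w : X → Fm → ℚ, (∀ x y a, IsModalComb a → w x a = w y a) ∧
      (∀ j ∈ J, ((s j).map (w (p j))).sum ≤ ((t j).map (w (p j))).sum) ∧
      w x₀ ν < w x₀ (bot ⇒ bot) := by
  let A : ι → (Fm ⊕ X × Fm → ℚ) →ₗ[ℚ] ℚ := fun j =>
    sumCoord ((s j).map (key (p j))) - sumCoord ((t j).map (key (p j)))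
  let γ : (Fm ⊕ X × Fm → ℚ) →ₗ[ℚ] ℚ := sumCoord {.inl (bot ⇒ bot)} - sumCoord {.inl ν}
  by_cases h : ∀ f, (∀ j ∈ J, A j f ≤ 0) → γ f ≤ 0
  · exfalso
    obtain ⟨l, hl, hγ⟩ := farkas J A γ h
    obtain ⟨N, hN, hn⟩ := exists_common_denominator J l hl
    choose! n hn using hn
    -- Clearing denominators in the Farkas identity and evaluating at unit vectors gives an identity
    -- of multiplicities, with negative terms moved across.
    have key_eq : ∀ k, N * (({.inl (bot ⇒ bot)} : Multiset (Fm ⊕ X × Fm)).count k) +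
        ∑ j ∈ J, n j * ((t j).map (key (p j))).count k =
        N * (({.inl ν} : Multiset (Fm ⊕ X × Fm)).count k) +
        ∑ j ∈ J, n j * ((s j).map (key (p j))).count k := by
      intro k
      have h1 := congrArg ((N : ℚ) * ·) (LinearMap.congr_fun hγ (Pi.single k 1))
      simp only [γ, A, LinearMap.sub_apply, LinearMap.sum_apply, LinearMap.smul_apply,
        sumCoord_single, Finset.mul_sum, smul_eq_mul] at h1
      have h2 : ∀ j ∈ J, (N : ℚ) * (l j * ((((s j).map (key (p j))).count k : ℚ) -
          ((t j).map (key (p j))).count k)) = n j * ((s j).map (key (p j))).count k -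
          n j * ((t j).map (key (p j))).count k := fun j hj => by
        rw [← mul_assoc, hn j hj, mul_sub]
      rw [Finset.sum_congr rfl h2, Finset.sum_sub_distrib] at h1
      have h3 : ((N * (({.inl (bot ⇒ bot)} : Multiset (Fm ⊕ X × Fm)).count k) +
        ∑ j ∈ J, n j * ((t j).map (key (p j))).count k : ℕ) : ℚ) =
        (N * (({.inl ν} : Multiset (Fm ⊕ X × Fm)).count k) +
        ∑ j ∈ J, n j * ((s j).map (key (p j))).count k : ℕ) := by
        push_cast
        linear_combination h1
      exact_mod_cast h3
    have h1 := fmSumLE_of_count_eq hF J p s t hJ N n {ν} {bot ⇒ bot}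
      (fun x a => by simpa [Multiset.count_singleton] using (key_eq (.inr (x, a))).symm)
      (fun a => by simpa [Multiset.count_singleton] using key_eq (.inl a)) x₀
    refine FmSumLE.not_nsmul (fun h2 => hν' ?_) hN h1
    rw [FmSumLE.singleton_iff] at h2
    exact IsLukTheory.mp (IsLukTheory.luk (.exfalso bot)) h2
  · push Not at h
    obtain ⟨f, hf, hγ⟩ := h
    refine ⟨fun x a => f (key x a), fun x y a ha => by simp [key, ha], fun j hj => ?_, ?_⟩
    · have := hf j hj
      simp only [A, LinearMap.sub_apply, sumCoord_apply, Multiset.map_map, sub_nonpos] at this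
      exact this
    · simpa [γ, sumCoord_apply, key, hν, isModalComb_top] using hγ

end Weights

/-! ### Modal theories and witnesses. -/

open Fm IsLukTheory MVAlgebra Lind

/-- Deductively closed sets of the calculus `S5(Ł)`. -/
class IsS5Theory (T : Set Fm) : Prop extends IsLukTheory T where
  s5 {φ : Fm} : S5Axiom φ → φ ∈ T
  nec {φ : Fm} : φ ∈ T → box φ ∈ T

lemma isS5Theory_provable (Γ : Set Fm) : IsS5Theory {φ | Provable Γ φ} where
  luk h := .ax (.luk h)
  mp h h' := .mp h h'
  s5 h := .ax h
  nec h := .nec h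

lemma isModalComb_pow {ν : Fm} (h : IsModalComb ν) : ∀ n, IsModalComb (Fm.pow ν n)
  | 0 => isModalComb_top
  | n + 1 => .conj (isModalComb_pow h n) h

namespace IsS5Theory

variable {T : Set Fm} [IsS5Theory T] {a b ν μ : Fm}

lemma imp_box (hν : IsModalComb ν) (h : ν ⇒ a ∈ T) : ν ⇒ box a ∈ T :=
  mp (nec h) (s5 (.box_imp a ν hν))

lemma dia_imp (hν : IsModalComb ν) (h : a ⇒ ν ∈ T) : dia a ⇒ ν ∈ T :=
  mp (nec h) (s5 (.box_imp_dia a ν hν))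

/-- Necessitation survives because `νⁿ` is again a modal combination and so passes under `□`. -/
lemma isS5Theory_adjoin (hν : IsModalComb ν) : IsS5Theory (adjoin T ν) where
  s5 h := subset_adjoin ν (s5 h)
  nec := by
    rintro φ ⟨n, h⟩
    exact ⟨n, imp_box (isModalComb_pow hν n) h⟩

lemma dia_conj_self_mem (h : dia a ∈ T) : dia (a ⊛ a) ∈ T := by
  have h1 : dia a ⊛ dia a ∈ T := mp h (mp h (imp_imp_iff.2 (imp_refl T _)))
  have h2 : Fm.equiv (dia (a ⊛ a)) (dia a ⊛ dia a) ∈ T := s5 (.dia_conj a)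
  exact mp h1 (mp h2 (imp_imp_iff.1 (imp_swap (imp_refl T _))))

/-- The axiom on `◇` concerns squares only, so `b` is obtained by repeated squaring of `a`, which
overshoots the exponent `n`. -/
lemma exists_dia_mem_imp_pow (h : dia a ∈ T) (n : ℕ) :
    ∃ b, dia b ∈ T ∧ b ⇒ a ∈ T ∧ b ⇒ Fm.pow a n ∈ T := by
  induction n with
  | zero => exact ⟨a, h, imp_refl T a, imp_of_mem (luk (.exfalso bot)) a⟩
  | succ n ih =>
    obtain ⟨b, h1, h2, h3⟩ := ih
    exact ⟨b ⊛ b, dia_conj_self_mem h1, imp_trans (luk (.weak _ _)) h2, conj_mono h3 h2⟩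

/-- A formula that is possibly true can be adjoined without adding modal combinations. -/
lemma mem_of_mem_adjoin_of_dia_mem (h : dia a ∈ T) (hν : IsModalComb ν) (h' : ν ∈ adjoin T a) :
    ν ∈ T := by
  obtain ⟨n, h'⟩ := h'
  obtain ⟨b, h1, -, h2⟩ := exists_dia_mem_imp_pow h n
  exact mp h1 (dia_imp hν (imp_trans h2 h'))

lemma le_mk_or {x : Lind T} (h : x ≤ res (res (Lind.mk T a) (Lind.mk T b)) (Lind.mk T b)) :
    x ≤ Lind.mk T (Fm.or a b) :=
  le_conj_res h (h.trans_eq (res_res_comm _ _))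

lemma mk_or_self_le (a : Fm) : Lind.mk T (Fm.or a a) ≤ Lind.mk T a := by
  refine (conj_le_left (Lind.mk T ((a ⇒ a) ⇒ a)) (Lind.mk T (((a ⇒ a) ⇒ a) ⇒ ((a ⇒ a) ⇒ a)))).trans ?_
  rw [mk_imp, mk_imp, res_eq_top_iff.2 le_rfl, top_res]

/-- Infima are witnessed. -/
lemma dia_imp_box_mem (a : Fm) : dia (a ⇒ box a) ∈ T := by
  have hν := IsModalComb.box a
  have hμ := IsModalComb.dia (a ⇒ box a)
  have h1 : res (Lind.mk T a) (Lind.mk T (box a)) ≤ Lind.mk T (dia (a ⇒ box a)) :=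
    mk_le_mk.2 (s5 (.dia_intro _))
  have h2 : Lind.mk T (dia (a ⇒ box a) ⇒ box a) ≤ Lind.mk T (Fm.or a (box a)) :=
    -- Since `a → □a` lies below its possibility `d`, `d → □a` lies below `(a → □a) → □a`, which is
    -- `a ∨ □a`.
    le_mk_or (res_mono h1 le_rfl)
  have h3 : Lind.mk T (dia (a ⇒ box a) ⇒ box a) ≤ Lind.mk T (box a) :=
    -- The left side is modal, so `□` may be put on `a ∨ □a`; the axiom `box_or` then reduces it to
    -- `□a ∨ □a`.
    le_trans (mk_le_mk.2 (imp_trans (imp_box (.imp hμ hν) (mk_le_mk.1 h2))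
      (s5 (.box_or a _ hν)))) (mk_or_self_le _)
  have h4 : res (res (Lind.mk T (dia (a ⇒ box a))) (Lind.mk T (box a))) (Lind.mk T (box a)) = ⊤ :=
    res_eq_top_iff.2 h3
  -- Commuting the join turns `h4` into `(□a → d) → d = ⊤`, and `□a ≤ d`, so `d = ⊤`.
  rw [res_res_comm, res_eq_top_iff.2 ((le_res _ _).trans h1), top_res] at h4
  exact mk_eq_top_iff.1 h4

/-- Suprema are witnessed. -/
lemma dia_dia_imp_mem (a : Fm) : dia (dia a ⇒ a) ∈ T := by
  have h1 : res (Lind.mk T (dia a)) (Lind.mk T a) ≤ Lind.mk T (dia (dia a ⇒ a)) := mk_le_mk.2 (s5 (.dia_intro _))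
  have h2 : Lind.mk T a ≤ Lind.mk T (dia a) := mk_le_mk.2 (s5 (.dia_intro _))
  have h3 : Lind.mk T a ≤ Lind.mk T (dia a ⊛ dia (dia a ⇒ a)) := by
    conv_lhs => rw [← conj_res_of_le h2]
    exact MVAlgebra.conj_mono le_rfl h1
  have h4 : Lind.mk T (dia a) ≤ conj (Lind.mk T (dia a)) (Lind.mk T (dia (dia a ⇒ a))) :=
    mk_le_mk.2 (dia_imp (.conj (.dia _) (.dia _)) (mk_le_mk.1 h3))
  -- As `¬◇a ≤ d` for `d = ◇(◇a → a)`, the product `◇a * d` is not truncated and `d = (◇a → ◇a *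
  -- d)`.
  rw [← mk_eq_top_iff, ← res_conj ((res_mono le_rfl bot_le).trans h1), res_eq_top_iff]
  exact h4

end IsS5Theory

/-! ### Linear and prime extensions. -/

open IsS5Theory

/-- Underivable formulas are avoided by theories that are linear on modal combinations. -/
lemma exists_linear_s5Theory {Γ : Set Fm} {φ : Fm} (h : ¬ Provable Γ φ) :
    ∃ T : Set Fm, IsS5Theory T ∧ Γ ⊆ T ∧ φ ∉ T ∧
      ∀ ν μ, IsModalComb ν → IsModalComb μ → ν ⇒ μ ∈ T ∨ μ ⇒ ν ∈ T := by
  obtain ⟨T, hΓ, hT, hmax⟩ := zorn_subset_nonempty {T | IsS5Theory T ∧ φ ∉ T} (fun C hC hchain hne =>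
    ⟨⋃₀ C, ⟨{ toIsLukTheory := isLukTheory_sUnion hchain hne fun F hF => (hC hF).1.toIsLukTheory
              s5 := fun h => by
                obtain ⟨F, hF⟩ := hne
                exact ⟨F, hF, (hC hF).1.s5 h⟩
              nec := fun ⟨F, hF, h⟩ => ⟨F, hF, (hC hF).1.nec h⟩ },
      fun ⟨F, hF, h⟩ => (hC hF).2 h⟩, fun _ => Set.subset_sUnion_of_mem⟩)
    {ψ | Provable Γ ψ} ⟨isS5Theory_provable Γ, h⟩
  have := hT.1
  refine ⟨T, hT.1, fun γ hγ => hΓ (.hyp hγ), hT.2, fun ν μ hν hμ => ?_⟩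
  have key : ∀ ν μ, IsModalComb ν → IsModalComb μ → ν ⇒ μ ∉ T → φ ∈ adjoin T (ν ⇒ μ) := by
    intro ν μ hν hμ hn
    by_contra hφ
    exact hn (hmax ⟨isS5Theory_adjoin (.imp hν hμ), hφ⟩ (subset_adjoin _) (mem_adjoin _))
  by_contra! hn
  exact hT.2 (mem_of_mem_adjoin (key ν μ hν hμ hn.1) (key μ ν hμ hν hn.2))

/-- A formula that is possibly true belongs to a prime theory with the same modal combinations. -/
lemma exists_primeTheory {T : Set Fm} [IsS5Theory T] (hbot : bot ∉ T)
    (hT : ∀ ν μ, IsModalComb ν → IsModalComb μ → ν ⇒ μ ∈ T ∨ μ ⇒ ν ∈ T) {θ : Fm}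
    (hθ : dia θ ∈ T) :
    ∃ F : Set Fm, IsPrimeTheory F ∧ T ⊆ F ∧ θ ∈ F ∧ ∀ ν, IsModalComb ν → ν ∈ F → ν ∈ T := by
  -- Closure under necessitation is dropped: a world need not contain `□a` with `a`.
  obtain ⟨F, hF, hS, hmax⟩ := zorn_subset_nonempty
    {F | IsLukTheory F ∧ ∀ ν, IsModalComb ν → ν ∈ F → ν ∈ T} (fun C hC hchain hne =>
    ⟨⋃₀ C, ⟨isLukTheory_sUnion hchain hne fun F hF => (hC hF).1,
      fun ν hν ⟨F, hF, h⟩ => (hC hF).2 ν hν h⟩, fun _ => Set.subset_sUnion_of_mem⟩)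
    (adjoin T θ) ⟨inferInstance, fun ν hν h => mem_of_mem_adjoin_of_dia_mem hθ hν h⟩
  have := hS.1
  have hTF : T ⊆ F := (subset_adjoin θ).trans hF
  refine ⟨F, { total := fun a b => ?_, bot_notMem := fun h => hbot (hS.2 _ .bot h) }, hTF,
    hF (mem_adjoin θ), hS.2⟩
  have key : ∀ a b, a ⇒ b ∉ F → ∃ ν, IsModalComb ν ∧ ν ∈ adjoin F (a ⇒ b) ∧ ν ∉ T := by
    intro a b hn
    by_contra! h
    exact hn (hmax ⟨inferInstance, h⟩ (subset_adjoin _) (mem_adjoin _))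
  by_contra! hn
  obtain ⟨ν, hν, h1, h2⟩ := key a b hn.1
  obtain ⟨μ, hμ, h3, h4⟩ := key b a hn.2
  -- The larger of `ν` and `μ` follows from both `a → b` and `b → a`, hence lies in `F` by
  -- prelinearity, and so in `T`.
  rcases hT ν μ hν hμ with h | h
  · exact h4 (hS.2 _ hμ (mem_of_mem_adjoin (mp h1 (subset_adjoin _ (hTF h))) h3))
  · exact h2 (hS.2 _ hν (mem_of_mem_adjoin h1 (mp h3 (subset_adjoin _ (hTF h)))))

/-- The prime theories serve as worlds that witness the value of a modal formula. -/
lemma exists_witness {T : Set Fm} [IsS5Theory T] (hbot : bot ∉ T)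
    (hT : ∀ ν μ, IsModalComb ν → IsModalComb μ → ν ⇒ μ ∈ T ∨ μ ⇒ ν ∈ T) (ψ : Fm) :
    ∃ F : Set Fm, IsPrimeTheory F ∧ T ⊆ F ∧ (∀ ν, IsModalComb ν → (ν ∈ F ↔ ν ∈ T)) ∧
      (∀ a, ψ = box a → a ⇒ box a ∈ F) ∧ ∀ a, ψ = dia a → dia a ⇒ a ∈ F := by
  have key : ∃ θ, dia θ ∈ T ∧ (∀ a, ψ = box a → θ = (a ⇒ box a)) ∧
      ∀ a, ψ = dia a → θ = (dia a ⇒ a) := by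
    cases ψ with
    | box a => exact ⟨_, dia_imp_box_mem a, by simp, by simp⟩
    | dia a => exact ⟨_, dia_dia_imp_mem a, by simp, by simp⟩
    -- A non-modal formula imposes no condition; any formula whose possibility is in `T` would do.
    | _ => exact ⟨_, dia_dia_imp_mem bot, by simp, by simp⟩
  obtain ⟨θ, hθ, h1, h2⟩ := key
  obtain ⟨F, hF, hTF, hθF, hM⟩ := exists_primeTheory hbot hT hθ
  exact ⟨F, hF, hTF, fun ν hν => ⟨hM ν hν, fun h => hTF h⟩, fun a ha => h1 a ha ▸ hθF,
    fun a ha => h2 a ha ▸ hθF⟩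

/-! ### The finite countermodel. -/

open Fm IsLukTheory MVAlgebra Lind

/-- The subformulas of a formula. -/
def Fm.subformulas : Fm → Set Fm
  | var p => {var p}
  | bot => {bot}
  | conj a b => {a ⊛ b} ∪ (subformulas a ∪ subformulas b)
  | imp a b => {a ⇒ b} ∪ (subformulas a ∪ subformulas b)
  | box a => {box a} ∪ subformulas a
  | dia a => {dia a} ∪ subformulas a

lemma finite_subformulas (a : Fm) : (Fm.subformulas a).Finite := by
  induction a with
  | var | bot => exact Set.finite_singleton _
  | conj _ _ h h' | imp _ _ h h' => exact (Set.finite_singleton _).union (h.union h')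
  | box _ h | dia _ h => exact (Set.finite_singleton _).union h

lemma mem_subformulas_self (a : Fm) : a ∈ Fm.subformulas a := by
  cases a <;> simp [Fm.subformulas]

/-- An assignment of values that respects the connectives on a set of formulas gives the truth
values of its formulas. -/
lemma truth_eq_of_subformulas_subset {X : Type*} (S : Set Fm) (v : X → Fm → unitInterval)
    (hbot : ∀ x, v x bot = 0)
    (hconj : ∀ x a b, a ∈ S → b ∈ S → a ⊛ b ∈ S → v x (a ⊛ b) = tnorm (v x a) (v x b))
    (himp : ∀ x a b, a ∈ S → b ∈ S → a ⇒ b ∈ S → v x (a ⇒ b) = resid (v x a) (v x b))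
    (hbox : ∀ x a, a ∈ S → box a ∈ S → v x (box a) = ⨅ y, v y a)
    (hdia : ∀ x a, a ∈ S → dia a ∈ S → v x (dia a) = ⨆ y, v y a) (a : Fm)
    (ha : Fm.subformulas a ⊆ S) (x : X) : truth (fun x p => v x (var p)) a x = v x a := by
  induction a generalizing x with
  | var p => rfl
  | bot => exact (hbot x).symm
  | conj a b iha ihb =>
    simp only [Fm.subformulas, Set.union_subset_iff, Set.singleton_subset_iff] at ha
    rw [truth, iha ha.2.1, ihb ha.2.2, hconj x a b (ha.2.1 (mem_subformulas_self a))
      (ha.2.2 (mem_subformulas_self b)) ha.1]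
  | imp a b iha ihb =>
    simp only [Fm.subformulas, Set.union_subset_iff, Set.singleton_subset_iff] at ha
    rw [truth, iha ha.2.1, ihb ha.2.2, himp x a b (ha.2.1 (mem_subformulas_self a))
      (ha.2.2 (mem_subformulas_self b)) ha.1]
  | box a ih =>
    simp only [Fm.subformulas, Set.union_subset_iff, Set.singleton_subset_iff] at ha
    rw [truth, hbox x a (ha.2 (mem_subformulas_self a)) ha.1]
    exact iInf_congr fun y => ih ha.2 y
  | dia a ih =>
    simp only [Fm.subformulas, Set.union_subset_iff, Set.singleton_subset_iff] at ha
    rw [truth, hdia x a (ha.2 (mem_subformulas_self a)) ha.1]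
    exact iSup_congr fun y => ih ha.2 y

section Pairs

variable {F : Set Fm} [IsPrimeTheory F] {a b : Fm}

lemma fmSumLE_conj_pair (h : oplus (mk F a) (mk F b) = ⊤) :
    FmSumLE F {a ⊛ b, bot ⇒ bot} {a, b} ∧ FmSumLE F {a, b} {a ⊛ b, bot ⇒ bot} := by
  have h1 : total (({a ⊛ b, bot ⇒ bot} : Multiset Fm).map (mk F)) =
    total (({a, b} : Multiset Fm).map (mk F)) := total_pair h
  exact ⟨le_of_eq (α := ℕ ×ₗ Lind F) (congrArg toLex h1),
    le_of_eq (α := ℕ ×ₗ Lind F) (congrArg toLex h1.symm)⟩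

/-- For `b ≤ a` the implication is linear, `b + 1 = (a → b) + a`: this is `total_pair` for `a → b`
and `a`, whose product is `b`. -/
lemma fmSumLE_imp_pair (h : b ⇒ a ∈ F) :
    FmSumLE F {b, bot ⇒ bot} {a ⇒ b, a} ∧ FmSumLE F {a ⇒ b, a} {b, bot ⇒ bot} := by
  have h0 : MVAlgebra.conj (mk F (a ⇒ b)) (mk F a) = mk F b := by
    rw [conj_comm]
    exact conj_res_of_le (mk_le_mk.2 h)
  have h1 : oplus (mk F (a ⇒ b)) (mk F a) = ⊤ := by
    rw [oplus_comm, oplus_eq_top_iff, mk_imp]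
    exact res_mono le_rfl bot_le
  have h2 : total (({b, bot ⇒ bot} : Multiset Fm).map (mk F)) =
    total (({a ⇒ b, a} : Multiset Fm).map (mk F)) := by
    refine Eq.trans ?_ (total_pair h1)
    rw [h0]
    rfl
  exact ⟨le_of_eq (α := ℕ ×ₗ Lind F) (congrArg toLex h2),
    le_of_eq (α := ℕ ×ₗ Lind F) (congrArg toLex h2.symm)⟩

end Pairs

/-- The multisets of at most two elements of `S`. -/
def smallMultisets (S : Set Fm) : Set (Multiset Fm) :=
  {0} ∪ ((fun a => {a}) '' S ∪ Set.image2 (fun a b => {a, b}) S S)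

/-- Values normalized to the unit interval. -/
noncomputable def normalize (c w : ℚ) : unitInterval :=
  Set.projIcc 0 1 zero_le_one ((w / c : ℚ) : ℝ)

lemma coe_normalize {c w : ℚ} (hc : 0 < c) (h0 : 0 ≤ w) (h1 : w ≤ c) :
    (normalize c w : ℝ) = ((w / c : ℚ) : ℝ) := by
  have h2 : (0 : ℝ) ≤ ((w / c : ℚ) : ℝ) := by exact_mod_cast div_nonneg h0 hc.le
  have h3 : ((w / c : ℚ) : ℝ) ≤ 1 := by exact_mod_cast (div_le_one hc).2 h1
  rw [normalize, Set.projIcc_of_mem _ ⟨h2, h3⟩]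

lemma normalize_mono {c w w' : ℚ} (hc : 0 < c) (h : w ≤ w') : normalize c w ≤ normalize c w' :=
  Set.monotone_projIcc _ (by exact_mod_cast div_le_div_of_nonneg_right h hc.le)

section Local

variable {F : Set Fm} [IsPrimeTheory F] {S : Set Fm} {w : Fm → ℚ} (htop : bot ⇒ bot ∈ S)
  (hbot : bot ∈ S) (hc : 0 < w (bot ⇒ bot))
  (hw : ∀ s ∈ smallMultisets S, ∀ t ∈ smallMultisets S, FmSumLE F s t →
    (s.map w).sum ≤ (t.map w).sum)

include hw

lemma value_le {a b : Fm} (ha : a ∈ S) (hb : b ∈ S) (h : a ⇒ b ∈ F) : w a ≤ w b := by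
  simpa using hw {a} (.inr (.inl ⟨a, ha, rfl⟩)) {b} (.inr (.inl ⟨b, hb, rfl⟩))
    (FmSumLE.singleton_iff.2 h)

lemma pair_value_le {a b c d : Fm} (ha : a ∈ S) (hb : b ∈ S) (hc : c ∈ S) (hd : d ∈ S)
    (h : FmSumLE F {a, b} {c, d}) : w a + w b ≤ w c + w d := by
  simpa using hw {a, b} (.inr (.inr ⟨a, ha, b, hb, rfl⟩)) {c, d} (.inr (.inr ⟨c, hc, d, hd, rfl⟩)) h

include hbot in
lemma value_bot : w bot = 0 := by
  have h0 : (0 : Multiset Fm) ∈ smallMultisets S := .inl rfl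
  have h1 : ({bot} : Multiset Fm) ∈ smallMultisets S := .inr (.inl ⟨bot, hbot, rfl⟩)
  have h2 := hw _ h1 _ h0 (bot_sumLE_zero (A := Lind F))
  have h3 := hw _ h0 _ h1 (zero_sumLE _)
  simp only [Multiset.map_singleton, Multiset.sum_singleton, Multiset.map_zero,
    Multiset.sum_zero] at h2 h3
  exact le_antisymm h2 h3

include hbot in
lemma value_nonneg {a : Fm} (ha : a ∈ S) : 0 ≤ w a := by
  rw [← value_bot hbot hw]
  exact value_le hw hbot ha (luk (.exfalso a))

include htop in
lemma value_le_top {a : Fm} (ha : a ∈ S) : w a ≤ w (bot ⇒ bot) :=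
  value_le hw ha htop (imp_of_mem (luk (.exfalso bot)) a)

include htop hbot hc

lemma coe_normalize_value {a : Fm} (ha : a ∈ S) :
    (normalize (w (bot ⇒ bot)) (w a) : ℝ) = ((w a / w (bot ⇒ bot) : ℚ) : ℝ) :=
  coe_normalize hc (value_nonneg hbot hw ha) (value_le_top htop hw ha)

/-- Comparisons with at most two terms on each side determine the product: either `a * b + 1 = a +
b`, or `a * b = 0` and `a + b ≤ 1`. -/
lemma normalize_conj {a b : Fm} (ha : a ∈ S) (hb : b ∈ S) (hab : a ⊛ b ∈ S) :
    normalize (w (bot ⇒ bot)) (w (a ⊛ b)) =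
      tnorm (normalize (w (bot ⇒ bot)) (w a)) (normalize (w (bot ⇒ bot)) (w b)) := by
  apply Subtype.ext
  rw [coe_tnorm, coe_normalize_value htop hbot hc hw hab, coe_normalize_value htop hbot hc hw ha,
    coe_normalize_value htop hbot hc hw hb]
  have h0 := value_nonneg hbot hw hab
  suffices h : w (a ⊛ b) / w (bot ⇒ bot) =
      max 0 (w a / w (bot ⇒ bot) + w b / w (bot ⇒ bot) - 1) by
    rw [h]
    push_cast
    rfl
  by_cases h : oplus (mk F a) (mk F b) = ⊤
  · have h1 := fmSumLE_conj_pair h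
    have h2 : w a + w b = w (a ⊛ b) + w (bot ⇒ bot) :=
      le_antisymm (pair_value_le hw ha hb hab htop h1.2) (pair_value_le hw hab htop ha hb h1.1)
    have h3 : w a / w (bot ⇒ bot) + w b / w (bot ⇒ bot) - 1 = w (a ⊛ b) / w (bot ⇒ bot) := by
      field_simp
      linarith
    rw [h3, max_eq_right (div_nonneg h0 hc.le)]
  · have h1 : a ⊛ b ⇒ bot ∈ F := mk_le_mk.1 (conj_eq_bot_of_oplus_ne_top h).le
    have h2 : w (a ⊛ b) = 0 :=
      le_antisymm ((value_le hw hab hbot h1).trans (value_bot hbot hw).le) h0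
    have h3 : w a + w b ≤ w (bot ⇒ bot) := by
      simpa using hw {a, b} (.inr (.inr ⟨a, ha, b, hb, rfl⟩)) {bot ⇒ bot}
        (.inr (.inl ⟨_, htop, rfl⟩)) (pair_sumLE_top h)
    rw [h2, zero_div, max_eq_left]
    rw [← add_div, sub_nonpos, div_le_one hc]
    exact h3

lemma normalize_imp {a b : Fm} (ha : a ∈ S) (hb : b ∈ S) (hab : a ⇒ b ∈ S) :
    normalize (w (bot ⇒ bot)) (w (a ⇒ b)) =
      resid (normalize (w (bot ⇒ bot)) (w a)) (normalize (w (bot ⇒ bot)) (w b)) := by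
  apply Subtype.ext
  rw [coe_resid, coe_normalize_value htop hbot hc hw hab, coe_normalize_value htop hbot hc hw ha,
    coe_normalize_value htop hbot hc hw hb]
  suffices h : w (a ⇒ b) / w (bot ⇒ bot) =
      min 1 (1 - w a / w (bot ⇒ bot) + w b / w (bot ⇒ bot)) by
    rw [h]
    push_cast
    rfl
  by_cases h : a ⇒ b ∈ F
  · have h1 : w (a ⇒ b) = w (bot ⇒ bot) :=
      le_antisymm (value_le_top htop hw hab) (value_le hw htop hab (imp_of_mem h _))
    have h2 := div_le_div_of_nonneg_right (value_le hw ha hb h) hc.le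
    rw [h1, div_self hc.ne', min_eq_left (by linarith)]
  · have h' := (IsPrimeTheory.total a b).resolve_left h
    have h1 := fmSumLE_imp_pair h'
    have h2 : w b + w (bot ⇒ bot) = w (a ⇒ b) + w a :=
      le_antisymm (pair_value_le hw hb htop hab ha h1.1) (pair_value_le hw hab ha hb htop h1.2)
    have h3 := div_le_div_of_nonneg_right (value_le hw hb ha h') hc.le
    rw [min_eq_right (by linarith)]
    field_simp
    linarith

end Local

/-- Completeness for finite sets of hypotheses. -/
theorem Provable.of_entails {Γ : Set Fm} (hΓ : Γ.Finite) {φ : Fm} (h : Entails.{u} Γ φ) :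
    Provable Γ φ := by
  by_contra hn
  obtain ⟨T, hT, hΓT, hφ, hlin⟩ := exists_linear_s5Theory hn
  -- `□φ` replaces `φ` because the formula separated from `⊤` must be modal.
  have hφ' : box φ ∉ T := fun h => hφ (IsLukTheory.mp h (IsS5Theory.s5 (.box_elim φ)))
  have hbotT : bot ∉ T := fun h => hφ (IsLukTheory.mp h (luk (.exfalso φ)))
  choose W hW hTW hMW hboxW hdiaW using fun ψ => exists_witness hbotT hlin ψ
  let S : Set Fm := Fm.subformulas (bot ⇒ bot) ∪ (Fm.subformulas (box φ) ∪
    ⋃ γ ∈ Γ, Fm.subformulas γ)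
  have hS : S.Finite := (finite_subformulas _).union ((finite_subformulas _).union
    (hΓ.biUnion fun γ _ => finite_subformulas γ))
  have htop : bot ⇒ bot ∈ S := .inl (mem_subformulas_self _)
  have hbot : bot ∈ S := .inl (by simp [Fm.subformulas])
  have hφS : Fm.subformulas (box φ) ⊆ S := fun _ h => .inr (.inl h)
  have hφS' : box φ ∈ S := hφS (mem_subformulas_self _)
  -- One world for each formula of `S`, namely a prime theory witnessing that formula; finiteness
  -- keeps the system of inequalities finite.
  let X : Type u := ULift.{u} S
  have : Finite S := hS
  let F : X → Set Fm := fun x => W x.down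
  have : ∀ x, IsPrimeTheory (F x) := fun x => hW _
  have hsmall : (smallMultisets S).Finite :=
    (Set.finite_singleton _).union ((hS.image _).union (hS.image2 _ hS))
  let x₀ : X := ⟨⟨box φ, hφS'⟩⟩
  have hJ : {j : X × Multiset Fm × Multiset Fm | j.2.1 ∈ smallMultisets S ∧
      j.2.2 ∈ smallMultisets S ∧ FmSumLE (F j.1) j.2.1 j.2.2}.Finite :=
    (Set.finite_univ.prod (hsmall.prod hsmall)).subset fun j hj => ⟨trivial, hj.1, hj.2.1⟩
  have hF : ∀ x y ν, IsModalComb ν → (ν ∈ F x ↔ ν ∈ F y) := fun x y ν hν =>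
    (hMW _ ν hν).trans (hMW _ ν hν).symm
  obtain ⟨w, hwM, hwJ, hlt⟩ := exists_rational_values hF hJ.toFinset (fun j => j.1)
    (fun j => j.2.1) (fun j => j.2.2) (fun j hj => ((Set.Finite.mem_toFinset hJ).1 hj).2.2)
    (.box φ) x₀ (fun h => hφ' ((hMW _ _ (.box φ)).1 h))
  have hw : ∀ x, ∀ s ∈ smallMultisets S, ∀ t ∈ smallMultisets S, FmSumLE (F x) s t →
      (s.map (w x)).sum ≤ (t.map (w x)).sum := fun x s hs t ht hst =>
    hwJ ⟨x, s, t⟩ ((Set.Finite.mem_toFinset hJ).2 ⟨hs, ht, hst⟩)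
  have hc : ∀ x, 0 < w x (bot ⇒ bot) := fun x => by
    rw [hwM x x₀ _ isModalComb_top]
    exact (value_nonneg hbot (hw x₀) hφS').trans_lt hlt
  let v : X → Fm → unitInterval := fun x a => normalize (w x (bot ⇒ bot)) (w x a)
  have hvle : ∀ x a b, a ∈ S → b ∈ S → a ⇒ b ∈ F x → v x a ≤ v x b := fun x a b ha hb hab =>
    normalize_mono (hc x) (value_le (hw x) ha hb hab)
  have hvM : ∀ x y a, IsModalComb a → v x a = v y a := fun x y a ha => by
    simp only [v, hwM x y a ha, hwM x y _ isModalComb_top]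
  have hTF : ∀ x, T ⊆ F x := fun x => hTW _
  have hbox : ∀ x a, a ∈ S → box a ∈ S → v x (box a) = ⨅ y, v y a := by
    intro x a ha hba
    refine le_antisymm (le_iInf fun y => ?_) ?_
    · rw [hvM x y _ (.box a)]
      exact hvle y _ _ hba ha (hTF y (IsS5Theory.s5 (.box_elim a)))
    -- The world indexed by `□a` contains `a → □a`, so the infimum is attained there.
    · let y : X := ⟨⟨box a, hba⟩⟩
      rw [hvM x y _ (.box a)]
      exact (iInf_le _ y).trans (hvle y _ _ ha hba (hboxW _ a rfl))
  have hdia : ∀ x a, a ∈ S → dia a ∈ S → v x (dia a) = ⨆ y, v y a := by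
    intro x a ha hda
    refine le_antisymm ?_ (iSup_le fun y => ?_)
    · let y : X := ⟨⟨dia a, hda⟩⟩
      rw [hvM x y _ (.dia a)]
      exact le_trans (hvle y _ _ hda ha (hdiaW _ a rfl)) (le_iSup (fun y => v y a) y)
    · rw [hvM x y _ (.dia a)]
      exact hvle y _ _ ha hda (hTF y (IsS5Theory.s5 (.dia_intro a)))
  have htruth := truth_eq_of_subformulas_subset S v
    (fun x => Subtype.ext (by
      simp only [v]
      rw [coe_normalize_value htop hbot (hc x) (hw x) hbot, value_bot hbot (hw x)]
      simp))
    (fun x a b ha hb hab => normalize_conj htop hbot (hc x) (hw x) ha hb hab)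
    (fun x a b ha hb hab => normalize_imp htop hbot (hc x) (hw x) ha hb hab) hbox hdia
  have hvtop : ∀ x, v x (bot ⇒ bot) = 1 := fun x => Subtype.ext (by
    simp only [v]
    rw [coe_normalize_value htop hbot (hc x) (hw x) htop, div_self (hc x).ne']
    simp)
  have : Nonempty X := ⟨x₀⟩
  have hmodel : IsModel (fun x p => v x (var p)) Γ := by
    intro γ hγ x
    have hγS : Fm.subformulas γ ⊆ S := fun a ha => .inr (.inr (Set.mem_biUnion hγ ha))
    rw [htruth γ hγS, ← hvtop x]
    refine le_antisymm (by rw [hvtop]; exact unitInterval.le_one') ?_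
    exact hvle x _ _ htop (hγS (mem_subformulas_self γ)) (imp_of_mem (hTF x (hΓT hγ)) _)
  have h1 : ∀ x, truth (fun x p => v x (var p)) φ x = 1 := h X _ hmodel φ rfl
  have h2 : truth (fun x p => v x (var p)) (box φ) x₀ = 1 :=
    le_antisymm unitInterval.le_one' (le_iInf fun x => (h1 x).ge)
  rw [htruth _ hφS] at h2
  have h3 := congrArg (Subtype.val) h2
  simp only [v] at h3
  rw [coe_normalize_value htop hbot (hc x₀) (hw x₀) hφS'] at h3
  have h4 := Rat.cast_injective (α := ℝ) (h3.trans Rat.cast_one.symm)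
  rw [div_eq_one_iff_eq (hc x₀).ne'] at h4
  exact hlt.ne h4

lemma Provable.entails {Γ : Set Fm} {φ : Fm} (h : Provable Γ φ) : Entails.{u} Γ φ := by
  rintro X _ e he _ rfl x
  exact h.sound he x

end S5Luk

theorem mainTheorem1 :
    -- finite strong completeness (with soundness)
    (∀ (Γ : Set S5Luk.Fm) (φ : S5Luk.Fm), Γ.Finite →
      (S5Luk.Provable Γ φ ↔ S5Luk.Entails.{u} Γ φ)) ∧
    -- `S5(Ł)` is the finitary companion of `S5([0,1])`
    (∀ (Γ : Set S5Luk.Fm) (φ : S5Luk.Fm),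
      S5Luk.Provable Γ φ ↔ ∃ Δ : Set S5Luk.Fm, Δ ⊆ Γ ∧ Δ.Finite ∧ S5Luk.Entails.{u} Δ φ) := by
  refine ⟨fun Γ φ hΓ => ⟨S5Luk.Provable.entails, .of_entails hΓ⟩, fun Γ φ => ⟨fun h => ?_, ?_⟩⟩
  · obtain ⟨Δ, hΔ, hf, h⟩ := h.exists_finite
    exact ⟨Δ, hΔ, hf, h.entails⟩
  · rintro ⟨Δ, hΔ, hf, h⟩
    exact (S5Luk.Provable.of_entails hf h).mono hΔ
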